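/- Consider $H=-\partial_z^2+W$ on $L^2([0,1])$ with Dirichlet boundary conditions, and count eigenvalues in increasing order with multiplicity. (a) Let $W\ge 0$ be continuous on $[0,1]$, so that $H$ acts on $H^2(0,1)\cap H^1_0(0,1)$. Then $H$ has a lowest eigenvalue $e_0$ and a second eigenvalue $e_1$, $0<e_0<e_1$, and with $\eta>0$ defined by $\eta^2=\pi^2+3\int_0^1W(z)\,dz$, $$e_1-e_0\ \ge\ \eta\,\ln\left(1+\pi e^{-2\eta}\right).$$ (b) Let $m\in\{0,1,2,\dots\}$, $\sigma\ge 0$, $\gamma\ge 0$, $z_1,\dots,z_m\in[0,1]$, let $\psi\in H^1_0(0,1)$ with $\int_0^1|\psi|^2=1$ (for instance the normalized minimizer $\psi_0$ of the Gross–Pitaevskii functional $\int_0^1(|\psi'|^2+V|\psi|^2+\frac{\gamma}{2}|\psi|^4)\,dz$, $V=\sigma\sum_{i=1}^m\delta(\cdot-z_i)$), and let $$W(z)=\sigma\sum_{i=1}^m\delta(z-z_i)+\gamma|\psi(z)|^2,$$ where $H$ is the self-adjoint operator of the quadratic form $\int_0^1|u'|^2+\sigma\sum_{i=1}^m|u(z_i)|^2+\gamma\int_0^1|\psi|^2|u|^2$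 on $H^1_0(0,1)$. Then $H$ has a lowest eigenvalue $e_0$ and a second eigenvalue $e_1$, $0<e_0<e_1$, and $$e_1-e_0\ \ge\ \eta\,\ln\left(1+\pi e^{-2\eta}\right),\qquad \eta=\sqrt{\pi^2+3m\sigma+3\gamma}.$$ This bound does not depend on the positions $z_i$. -/

import Mathlib

open MeasureTheory
open scoped ComplexConjugate

noncomputable section

namespace EnergyGap

/-- Lebesgue measure on the unit interval. -/
def unitVolume : Measure ℝ := volume.restrict (Set.Icc 0 1)

/-- `u` belongs to `H¹₀(0,1)` and `u'` is (a representative of) its weak derivative: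
`u` is absolutely continuous on `[0,1]` with square integrable derivative `u'`
and vanishes at both end points. Functions on the unit interval are extended by zero
to the real line, so that equality of functions is equality on `[0,1]`. -/
def IsH10 (u u' : ℝ → ℂ) : Prop :=
  MemLp u' 2 unitVolume ∧
    (∀ x ∈ Set.Icc (0 : ℝ) 1, u x = ∫ t in (0 : ℝ)..x, u' t) ∧
    ∀ x ∉ Set.Ioo (0 : ℝ) 1, u x = 0

/-- The graph of the Dirichlet operator `H = -∂² + W` on `L²([0,1])` for a function `W`:
`u ∈ H²(0,1) ∩ H¹₀(0,1)` and `-u'' + W u = f` almost everywhere on `[0,1]`. -/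
def SchrodingerGraph (W : ℝ → ℝ) (u f : ℝ → ℂ) : Prop :=
  ∃ u' u'' : ℝ → ℂ, IsH10 u u' ∧ MemLp u'' 2 unitVolume ∧
    (∀ x ∈ Set.Icc (0 : ℝ) 1, u' x = u' 0 + ∫ t in (0 : ℝ)..x, u'' t) ∧
    ∀ᵐ x ∂unitVolume, -u'' x + (W x : ℂ) * u x = f x

/-- The graph of the Dirichlet operator `H = -∂² + W` on `L²([0,1])` when `W` is a
finite positive measure `μ` (for instance one with point masses): the self-adjoint operator
of the closed quadratic form `∫ |u'|² + ∫ |u|² dμ` with form domain `H¹₀(0,1)`. -/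
def FormGraph (μ : Measure ℝ) (u f : ℝ → ℂ) : Prop :=
  ∃ u' : ℝ → ℂ, IsH10 u u' ∧ MemLp f 2 unitVolume ∧
    ∀ v v' : ℝ → ℂ, IsH10 v v' →
      (∫ x, conj (v' x) * u' x ∂unitVolume) + ∫ x, conj (v x) * u x ∂μ
        = ∫ x, conj (v x) * f x ∂unitVolume

/-- `e` is the `n`-th eigenvalue (`n = 0, 1, 2, …`), in increasing order and counted with
multiplicity, of the self-adjoint operator with graph `G`: the least `E` such that there are
`n + 1` linearly independent eigenfunctions whose eigenvalues are at most `E`. -/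
def IsNthEigenvalue (G : (ℝ → ℂ) → (ℝ → ℂ) → Prop) (n : ℕ) (e : ℝ) : Prop :=
  IsLeast {E : ℝ | ∃ u : Fin (n + 1) → ℝ → ℂ, LinearIndependent ℂ u ∧
    ∀ i, ∃ lam : ℝ, lam ≤ E ∧ G (u i) (fun x => (lam : ℂ) * u i x)} e

/-- The potential `σ ∑ᵢ δ(z - zᵢ) + γ |ψ(z)|²` on `[0,1]`, as a measure. -/
def scattererPotential (m : ℕ) (σ γ : ℝ) (z : Fin m → ℝ) (ψ : ℝ → ℂ) : Measure ℝ :=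
  ENNReal.ofReal σ • ∑ i, Measure.dirac (z i) +
    unitVolume.withDensity (fun x => ENNReal.ofReal (γ * ‖ψ x‖ ^ 2))

end EnergyGap

end

/-!
Both operators are treated as `-∂² + μ` with a finite measure `μ` on `[0,1]` (in the first case
with density `W`). Their eigenfunctions are the multiples of the solution `shoot μ lam` of the
initial value problem `u(0) = 0`, `u'(0) = 1`, written as a Volterra integral equation, for those
`lam` at which it vanishes at `1` (`FormGraph.eq_smul_eigenfun`,
`SchrodingerGraph.eq_smul_eigenfun` and the converses `formGraph_eigenfun`,
`schrodingerGraph_eigenfun`). In particular all eigenvalues are simple. The least such `lam` is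
positive and its solution `u` has no zero inside the interval (`exists_ground_state`);
comparison with `sin (k x)` gives arbitrarily large zeros (`exists_shoot_one_eq_zero_gt`).

The gap comes from the quotient `g = v/u` of another eigenfunction `v`, with eigenvalue `b`, and
the ground state `u`, with eigenvalue `a`. It satisfies `u² g' = -(b - a) ∫₀ˣ u² g`
(`IsVolterraSol.wronskian`), and it changes sign because `∫ u v = 0`. The Riccati equation
`(u'/u)' = μ - a - (u'/u)²` bounds `∫ (u'/u)²` by the mass `M` of `μ` between a point where `u`
does not increase and a later one where it does not decrease. Hence, for every `κ > 0`, up to the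
factor `C = exp ((κ + M/κ)/2)` the function `u` is increasing before its maximum
(`IsVolterraSol.le_exp_mul_of_le`) and, by reflection, decreasing after it. So `g` is
Lipschitz with constant `(b - a) C² sup |g|`, and since `g` changes sign, `1 ≤ (b - a) C²`
(`IsVolterraSol.exp_neg_le_sub`). The choice `κ = η/2` with `3 M ≤ η² - π²` gives
`b - a ≥ exp (-7η/6)`, which exceeds `η π exp (-2η) ≥ η log (1 + π exp (-2η))`
(`mul_log_le_exp_neg`). Applied with a fixed `κ`, the estimate also isolates the lowest eigenvalue
from the others, so that there is a second one.
-/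

namespace EnergyGap

open Set Filter Topology

/-! ### The initial value problem as a Volterra equation -/

/-- `u` is a solution on `[0,1]` of `-u'' + μ u = lam u` with `u(0) = 0` and `u'(0) = c`, in the
integrated form `u(x) = c x + ∫ (x - t)₊ u(t) (dμ(t) - lam dt)`, which makes sense for potentials
with point masses. -/
def IsVolterraSol (μ : Measure ℝ) (lam c : ℝ) (u : ℝ → ℝ) : Prop :=
  ContinuousOn u (Icc 0 1) ∧ ∀ x ∈ Icc (0 : ℝ) 1,
    u x = c * x + (∫ t in Icc (0 : ℝ) 1, max (x - t) 0 * u t ∂μ)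
      - lam * ∫ t in Icc (0 : ℝ) 1, max (x - t) 0 * u t

theorem max_sub_mul_pow_le {x t : ℝ} (hx : 0 ≤ x) (ht : 0 ≤ t) (n : ℕ) :
    ((n : ℝ) + 1) * (max (x - t) 0 * t ^ n) ≤ x ^ (n + 1) := by
  rcases le_total x t with h | h
  · rw [max_eq_right (by linarith)]
    simp only [zero_mul, mul_zero]
    positivity
  rw [max_eq_left (by linarith)]
  induction n with
  | zero => simp; linarith
  | succ n ih =>
    have h1 : t ^ (n + 1) * (x - t) ≤ x ^ (n + 1) * (x - t) :=
      mul_le_mul_of_nonneg_right (pow_le_pow_left₀ ht h _) (by linarith)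
    have h2 := mul_le_mul_of_nonneg_left ih ht
    push_cast
    calc ((n : ℝ) + 1 + 1) * ((x - t) * t ^ (n + 1))
        = t * (((n : ℝ) + 1) * ((x - t) * t ^ n)) + t ^ (n + 1) * (x - t) := by ring
      _ ≤ t * x ^ (n + 1) + x ^ (n + 1) * (x - t) := add_le_add h2 h1
      _ = x ^ (n + 1 + 1) := by ring

section Operator

variable (ρ : Measure ℝ) [IsLocallyFiniteMeasure ρ]

theorem integrableOn_Icc_of_continuousOn {f : ℝ → ℝ} {a b : ℝ} (hf : ContinuousOn f (Icc a b)) :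
    IntegrableOn f (Icc a b) ρ :=
  hf.integrableOn_compact isCompact_Icc

/-- A bound for integrals against the Volterra kernel, for integrands of polynomial growth. -/
theorem abs_integral_kernel_le {f : ℝ → ℝ} {x A : ℝ} (hx : x ∈ Icc (0 : ℝ) 1) (hA : 0 ≤ A)
    (n : ℕ) (hf : ∀ t ∈ Icc (0 : ℝ) 1, t ≤ x → |f t| ≤ A * t ^ n) :
    |∫ t in Icc (0 : ℝ) 1, max (x - t) 0 * f t ∂ρ|
      ≤ A * (x ^ (n + 1) / (n + 1)) * ρ.real (Icc 0 1) := by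
  have hfin : ρ (Icc 0 1) < ⊤ := isCompact_Icc.measure_lt_top
  rw [← Real.norm_eq_abs]
  refine norm_setIntegral_le_of_norm_le_const hfin (fun t ht => ?_)
  rw [Real.norm_eq_abs, abs_mul, abs_of_nonneg (le_max_right _ _)]
  have hn : (0 : ℝ) < n + 1 := by positivity
  rcases le_total t x with h | h
  · calc max (x - t) 0 * |f t| ≤ max (x - t) 0 * (A * t ^ n) :=
          mul_le_mul_of_nonneg_left (hf t ht h) (le_max_right _ _)
      _ = A * (max (x - t) 0 * t ^ n) := by ring
      _ ≤ A * (x ^ (n + 1) / (n + 1)) := by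
          refine mul_le_mul_of_nonneg_left ?_ hA
          rw [le_div_iff₀ hn, mul_comm]
          exact max_sub_mul_pow_le hx.1 ht.1 n
  · rw [max_eq_right (by linarith), zero_mul]
    have := hx.1
    positivity

/-- The Volterra operator `f ↦ ∫ (x - t)₊ f(t) dρ(t)` on the continuous functions on `[0,1]`. -/
noncomputable def volterra : C(Icc (0 : ℝ) 1, ℝ) →L[ℝ] C(Icc (0 : ℝ) 1, ℝ) :=
  LinearMap.mkContinuous
    { toFun := fun f =>
        ⟨fun x => ∫ t in Icc (0 : ℝ) 1, max ((x : ℝ) - t) 0 * IccExtend zero_le_one f t ∂ρ,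
          continuous_parametric_integral_of_continuous
            (f := fun (x : Icc (0 : ℝ) 1) t => max ((x : ℝ) - t) 0 * IccExtend zero_le_one f t)
            (by
              have := f.continuous.Icc_extend' (h := zero_le_one)
              simp only [Function.uncurry_def]
              fun_prop)
            isCompact_Icc⟩
      map_add' := fun f g => by
        ext x
        simp only [ContinuousMap.coe_mk, ContinuousMap.add_apply]
        have hf := f.continuous.Icc_extend' (h := zero_le_one)
        have hg := g.continuous.Icc_extend' (h := zero_le_one)
        rw [← integral_add]
        · refine integral_congr_ae (Eventually.of_forall fun t => ?_)
          simp [IccExtend, mul_add]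
        · exact integrableOn_Icc_of_continuousOn ρ (by fun_prop)
        · exact integrableOn_Icc_of_continuousOn ρ (by fun_prop)
      map_smul' := fun c f => by
        ext x
        simp only [ContinuousMap.coe_mk, ContinuousMap.smul_apply, RingHom.id_apply, smul_eq_mul]
        rw [← integral_const_mul]
        refine integral_congr_ae (Eventually.of_forall fun t => ?_)
        simp [IccExtend, mul_left_comm] }
    (ρ.real (Icc 0 1))
    (fun f => by
      refine (ContinuousMap.norm_le _ (by positivity)).2 fun x => ?_
      have h := abs_integral_kernel_le ρ (f := IccExtend zero_le_one f) x.2 (norm_nonneg f) 0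
        (fun t ht _ => by
          simpa [IccExtend] using f.norm_coe_le_norm _)
      refine h.trans ?_
      have h1 := x.2.2
      have h2 : (0 : ℝ) ≤ ρ.real (Icc 0 1) := measureReal_nonneg
      have h3 := norm_nonneg f
      simp only [zero_add, pow_one, Nat.cast_zero, div_one]
      nlinarith [mul_nonneg h2 h3])

theorem volterra_apply (f : C(Icc (0 : ℝ) 1, ℝ)) (x : Icc (0 : ℝ) 1) :
    volterra ρ f x
      = ∫ t in Icc (0 : ℝ) 1, max ((x : ℝ) - t) 0 * IccExtend zero_le_one f t ∂ρ := rfl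

end Operator

section Existence

variable (μ : Measure ℝ) [IsFiniteMeasure μ]

/-- The Volterra operator of the signed measure `μ - lam dt`. -/
noncomputable def shootOp (lam : ℝ) : C(Icc (0 : ℝ) 1, ℝ) →L[ℝ] C(Icc (0 : ℝ) 1, ℝ) :=
  volterra μ - lam • volterra volume

/-- Powers of a Volterra operator decay factorially, because each application gains a factor
`x / (n + 1)` even when the measure has atoms. -/
theorem abs_shootOp_pow_le (lam : ℝ) (f : C(Icc (0 : ℝ) 1, ℝ)) (n : ℕ) (x : Icc (0 : ℝ) 1) :
    |(shootOp μ lam ^ n) f x|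
      ≤ (μ.real (Icc 0 1) + |lam|) ^ n / n.factorial * ‖f‖ * (x : ℝ) ^ n := by
  induction n generalizing x with
  | zero => simpa using f.norm_coe_le_norm x
  | succ n ih =>
    set N := μ.real (Icc (0 : ℝ) 1) + |lam| with hN
    have hN0 : 0 ≤ N := by positivity
    set g := (shootOp μ lam ^ n) f with hg
    have hgb : ∀ t ∈ Icc (0 : ℝ) 1, t ≤ x →
        |IccExtend zero_le_one g t| ≤ N ^ n / n.factorial * ‖f‖ * t ^ n := fun t ht _ => by
      rw [IccExtend_of_mem zero_le_one g ht]
      exact ih ⟨t, ht⟩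
    have hA : 0 ≤ N ^ n / n.factorial * ‖f‖ := by positivity
    have h1 := abs_integral_kernel_le μ x.2 hA n hgb
    have h2 := abs_integral_kernel_le volume x.2 hA n hgb
    have hvol : (volume : Measure ℝ).real (Icc 0 1) = 1 := by simp
    rw [hvol, mul_one] at h2
    rw [pow_succ']
    change |volterra μ g x - lam * volterra volume g x| ≤ _
    rw [volterra_apply, volterra_apply]
    refine (abs_sub _ _).trans ?_
    rw [abs_mul]
    have h3 := mul_le_mul_of_nonneg_left h2 (abs_nonneg lam)
    refine (add_le_add h1 h3).trans (le_of_eq ?_)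
    rw [Nat.factorial_succ]
    push_cast
    have hx : (n.factorial : ℝ) ≠ 0 := by positivity
    rw [pow_succ N, hN]
    field_simp

/-- Some power `T ^ n` of the operator has norm less than `1`, and `1 - T` divides `1 - T ^ n`. -/
theorem isUnit_one_sub_shootOp (lam : ℝ) : IsUnit (1 - shootOp μ lam) := by
  obtain ⟨n, hn⟩ : ∃ n : ℕ, (μ.real (Icc (0 : ℝ) 1) + |lam|) ^ n / n.factorial < 1 :=
    ((FloorSemiring.tendsto_pow_div_factorial_atTop _).eventually (gt_mem_nhds one_pos)).exists
  have hT : ‖shootOp μ lam ^ n‖ < 1 := by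
    refine lt_of_le_of_lt (ContinuousLinearMap.opNorm_le_bound _ (by positivity) fun f => ?_) hn
    refine (ContinuousMap.norm_le _ (by positivity)).2 fun x => ?_
    refine (abs_shootOp_pow_le μ lam f n x).trans ?_
    exact mul_le_of_le_one_right (by positivity) (pow_le_one₀ x.2.1 x.2.2)
  have hu := isUnit_one_sub_of_norm_lt_one
    (R := C(Icc (0 : ℝ) 1, ℝ) →L[ℝ] C(Icc (0 : ℝ) 1, ℝ)) hT
  rw [← mul_neg_geom_sum] at hu
  have hc : Commute (1 - shootOp μ lam) (∑ i ∈ Finset.range n, shootOp μ lam ^ i) := by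
    refine Commute.sum_right _ _ _ fun i _ => ?_
    exact ((Commute.one_left _).sub_left ((Commute.refl _).pow_right i))
  exact (hc.isUnit_mul_iff.1 hu).1

/-- The solution of the initial value problem with slope `1`, as a continuous function. -/
noncomputable def shootMap (lam : ℝ) : C(Icc (0 : ℝ) 1, ℝ) :=
  Ring.inverse (1 - shootOp μ lam) ⟨fun x => (x : ℝ), continuous_subtype_val⟩

/-- The solution of the initial value problem with slope `1`, extended by constants to the line. -/
noncomputable def shoot (lam : ℝ) : ℝ → ℝ := IccExtend zero_le_one (shootMap μ lam)

theorem continuous_shootMap : Continuous (shootMap μ) := by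
  have h : Continuous fun lam : ℝ => Ring.inverse (1 - shootOp μ lam) := by
    refine continuous_iff_continuousAt.2 fun lam => ?_
    obtain ⟨w, hw⟩ := isUnit_one_sub_shootOp μ lam
    have h1 : ContinuousAt Ring.inverse (1 - shootOp μ lam) := by
      rw [← hw]
      exact NormedRing.inverse_continuousAt
        (R := C(Icc (0 : ℝ) 1, ℝ) →L[ℝ] C(Icc (0 : ℝ) 1, ℝ)) w
    have h2 : ContinuousAt (fun lam : ℝ => 1 - shootOp μ lam) lam := by
      unfold shootOp
      fun_prop
    exact ContinuousAt.comp (f := fun lam : ℝ => 1 - shootOp μ lam) h1 h2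
  exact h.clm_apply continuous_const

/-- Joint continuity in the spectral parameter and the position. -/
theorem continuous_shoot_uncurry : Continuous fun p : ℝ × ℝ => shoot μ p.1 p.2 := by
  have h : Continuous fun p : ℝ × ℝ => shootMap μ p.1 (projIcc 0 1 zero_le_one p.2) := by
    have h1 := (continuous_shootMap μ).comp (continuous_fst (X := ℝ) (Y := ℝ))
    have h2 := (continuous_projIcc (h := zero_le_one (α := ℝ))).comp
      (continuous_snd (X := ℝ) (Y := ℝ))
    exact ContinuousEval.continuous_eval.comp (h1.prodMk h2)
  exact h

theorem continuous_shoot (lam : ℝ) : Continuous (shoot μ lam) :=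
  (shootMap μ lam).continuous.Icc_extend'

theorem isVolterraSol_shoot (lam : ℝ) : IsVolterraSol μ lam 1 (shoot μ lam) := by
  refine ⟨(continuous_shoot μ lam).continuousOn, fun x hx => ?_⟩
  set e : C(Icc (0 : ℝ) 1, ℝ) := ⟨fun x => (x : ℝ), continuous_subtype_val⟩ with he
  have h : (1 - shootOp μ lam) (shootMap μ lam) = e := by
    change ((1 - shootOp μ lam) * Ring.inverse (1 - shootOp μ lam)) e = e
    rw [Ring.mul_inverse_cancel _ (isUnit_one_sub_shootOp μ lam)]
    rfl
  have h1 := DFunLike.congr_fun h ⟨x, hx⟩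
  change shootMap μ lam ⟨x, hx⟩ - (volterra μ (shootMap μ lam) ⟨x, hx⟩
    - lam * volterra volume (shootMap μ lam) ⟨x, hx⟩) = x at h1
  rw [volterra_apply, volterra_apply] at h1
  rw [show shoot μ lam x = shootMap μ lam ⟨x, hx⟩ from IccExtend_of_mem _ _ hx]
  simp only [shoot]
  linarith

variable {μ} in
/-- Uniqueness for the initial value problem. -/
theorem IsVolterraSol.eq_shoot {lam c : ℝ} {u : ℝ → ℝ} (hu : IsVolterraSol μ lam c u) {x : ℝ}
    (hx : x ∈ Icc (0 : ℝ) 1) : u x = c * shoot μ lam x := by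
  set f : C(Icc (0 : ℝ) 1, ℝ) := ⟨fun x => u x, continuousOn_iff_continuous_domRestrict.1 hu.1⟩
    with hf
  set e : C(Icc (0 : ℝ) 1, ℝ) := ⟨fun x => (x : ℝ), continuous_subtype_val⟩ with he
  have hext : ∀ t ∈ Icc (0 : ℝ) 1, IccExtend zero_le_one f t = u t := fun t ht => by
    rw [IccExtend_of_mem _ _ ht]; rfl
  have hV : ∀ (ρ : Measure ℝ) [IsLocallyFiniteMeasure ρ] (y : Icc (0 : ℝ) 1),
      volterra ρ f y = ∫ t in Icc (0 : ℝ) 1, max ((y : ℝ) - t) 0 * u t ∂ρ := fun ρ _ y => by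
    rw [volterra_apply]
    refine setIntegral_congr_fun measurableSet_Icc fun t ht => ?_
    simp only [hext t ht]
  have h : (1 - shootOp μ lam) f = c • e := by
    ext y
    change u y - (volterra μ f y - lam * volterra volume f y) = c * (y : ℝ)
    rw [hV, hV, hu.2 y y.2]
    ring
  have h2 : f = c • shootMap μ lam := by
    have h3 : (Ring.inverse (1 - shootOp μ lam) * (1 - shootOp μ lam)) f
        = c • shootMap μ lam := by
      change Ring.inverse (1 - shootOp μ lam) ((1 - shootOp μ lam) f) = _
      rw [h, map_smul]
      rfl
    rw [Ring.inverse_mul_cancel _ (isUnit_one_sub_shootOp μ lam)] at h3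
    exact h3
  have h4 := DFunLike.congr_fun h2 ⟨x, hx⟩
  rw [show shoot μ lam x = shootMap μ lam ⟨x, hx⟩ from IccExtend_of_mem _ _ hx]
  exact h4

end Existence

/-! ### Integration by parts against a measure -/

section Parts

variable {𝕜 : Type*} [RCLike 𝕜] (ρ : Measure ℝ) [SFinite ρ]

/-- Fubini's theorem on the triangle `y < s ≤ t ≤ x`. The half-open intervals matter when `ρ` has
atoms. -/
theorem intervalIntegrable_mul_integral_Ioc {f h : ℝ → 𝕜} {y x : ℝ} (hyx : y ≤ x)
    (hf : IntervalIntegrable f volume y x) (hh : IntegrableOn h (Ioc y x) ρ) :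
    IntervalIntegrable (fun t => f t * ∫ s in Ioc y t, h s ∂ρ) volume y x ∧
      ∫ t in y..x, f t * ∫ s in Ioc y t, h s ∂ρ
        = ∫ s in Ioc y x, h s * (∫ t in s..x, f t) ∂ρ := by
  rw [intervalIntegrable_iff_integrableOn_Ioc_of_le hyx] at hf ⊢
  have hmeas : MeasurableSet {p : ℝ × ℝ | p.2 ≤ p.1} :=
    measurableSet_le measurable_snd measurable_fst
  have hint := (Integrable.mul_prod hf hh).indicator hmeas
  have hinner : ∀ t ∈ Ioc y x, (∫ s in Ioc y x,
      {p : ℝ × ℝ | p.2 ≤ p.1}.indicator (fun p => f p.1 * h p.2) (t, s) ∂ρ)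
        = f t * ∫ s in Ioc y t, h s ∂ρ := fun t ht => by
    have h1 : (fun s => {p : ℝ × ℝ | p.2 ≤ p.1}.indicator (fun p => f p.1 * h p.2) (t, s))
        = (Iic t).indicator (fun s => f t * h s) := by
      ext s
      simp [indicator]
    rw [h1, setIntegral_indicator measurableSet_Iic, Ioc_inter_Iic, min_eq_right ht.2,
      integral_const_mul]
  have houter : ∀ s ∈ Ioc y x, (∫ t in Ioc y x,
      {p : ℝ × ℝ | p.2 ≤ p.1}.indicator (fun p => f p.1 * h p.2) (t, s))
        = h s * ∫ t in s..x, f t := fun s hs => by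
    have h1 : (fun t => {p : ℝ × ℝ | p.2 ≤ p.1}.indicator (fun p => f p.1 * h p.2) (t, s))
        = (Ici s).indicator (fun t => h s * f t) := by
      ext t
      simp [indicator, mul_comm]
    have h2 : Ioc y x ∩ Ici s = Icc s x := by
      ext t
      simp only [mem_inter_iff, mem_Ioc, mem_Ici, mem_Icc]
      constructor
      · rintro ⟨⟨_, h⟩, h'⟩; exact ⟨h', h⟩
      · rintro ⟨h, h'⟩; exact ⟨⟨lt_of_lt_of_le hs.1 h, h'⟩, h⟩
    rw [h1, setIntegral_indicator measurableSet_Ici, h2, integral_const_mul,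
      integral_Icc_eq_integral_Ioc, intervalIntegral.integral_of_le hs.2]
  constructor
  · refine IntegrableOn.congr_fun hint.integral_prod_left (fun t ht => ?_) measurableSet_Ioc
    exact hinner t ht
  · rw [intervalIntegral.integral_of_le hyx, ← setIntegral_congr_fun measurableSet_Ioc hinner]
    exact (integral_integral_swap
      (f := fun t s => {p : ℝ × ℝ | p.2 ≤ p.1}.indicator (fun p => f p.1 * h p.2) (t, s))
      hint).trans (setIntegral_congr_fun measurableSet_Ioc houter)

/-- Integration by parts for an absolutely continuous function `F` with derivative `f` and a
right-continuous function `k` of bounded variation with `dk = h dρ`. -/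
theorem integral_mul_eq_sub_of_Ioc {f h F k : ℝ → 𝕜} {y x : ℝ} (hyx : y ≤ x)
    (hf : IntervalIntegrable f volume y x) (hh : IntegrableOn h (Ioc y x) ρ)
    (hF : ∀ t ∈ Icc y x, F t = F y + ∫ s in y..t, f s)
    (hk : ∀ t ∈ Icc y x, k t = k y + ∫ s in Ioc y t, h s ∂ρ) :
    IntervalIntegrable (fun t => f t * k t) volume y x ∧
      ∫ t in y..x, f t * k t = k x * F x - k y * F y - ∫ s in Ioc y x, h s * F s ∂ρ := by
  obtain ⟨h1, h2⟩ := intervalIntegrable_mul_integral_Ioc ρ hyx hf hh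
  have hsum : IntervalIntegrable
      (fun t => f t * k y + f t * ∫ s in Ioc y t, h s ∂ρ) volume y x :=
    (hf.mul_const _).add h1
  have hcongr : EqOn (fun t => f t * k y + f t * ∫ s in Ioc y t, h s ∂ρ) (fun t => f t * k t)
      (Icc y x) := fun t ht => by
    simp only [hk t ht, mul_add]
  have hcont : ContinuousOn F (Icc y x) := by
    have h3 : ContinuousOn (fun t => F y + ∫ s in y..t, f s) (Icc y x) := by
      have := intervalIntegral.continuousOn_primitive_interval
        (a := y) (b := x) (f := f) (μ := volume)
        (by rw [uIcc_of_le hyx]; exact (intervalIntegrable_iff_integrableOn_Icc_of_le hyx).1 hf)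
      rw [uIcc_of_le hyx] at this
      exact continuousOn_const.add this
    exact h3.congr hF
  have hFx : ∀ s ∈ Ioc y x, h s * (∫ t in s..x, f t) = h s * F x - h s * F s := fun s hs => by
    have hsub : IntervalIntegrable f volume y s :=
      hf.mono_set (by rw [uIcc_of_le hyx, uIcc_of_le hs.1.le]; exact Icc_subset_Icc_right hs.2)
    rw [hF x ⟨hyx, le_rfl⟩, hF s ⟨hs.1.le, hs.2⟩,
      ← intervalIntegral.integral_interval_sub_left hf hsub]
    ring
  have hhF : IntegrableOn (fun s => h s * F s) (Ioc y x) ρ := by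
    obtain ⟨C, hC⟩ := isCompact_Icc.exists_bound_of_continuousOn hcont
    refine Integrable.mul_bdd (c := C) hh ?_ ?_
    · exact (hcont.mono Ioc_subset_Icc_self).aestronglyMeasurable measurableSet_Ioc
    · exact (ae_restrict_mem measurableSet_Ioc).mono fun s hs => hC s (Ioc_subset_Icc_self hs)
  refine ⟨hsum.congr ?_, ?_⟩
  · rw [uIoc_of_le hyx]; exact hcongr.mono Ioc_subset_Icc_self
  · rw [← intervalIntegral.integral_congr (g := fun t => f t * k t)
      (by rw [uIcc_of_le hyx]; exact hcongr),
      intervalIntegral.integral_add (hf.mul_const _) h1, h2,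
      setIntegral_congr_fun measurableSet_Ioc hFx, integral_sub (hh.mul_const _) hhF,
      intervalIntegral.integral_mul_const, integral_mul_const]
    have e1 := hF x ⟨hyx, le_rfl⟩
    have e2 := hk x ⟨hyx, le_rfl⟩
    have e3 : (∫ s in y..x, f s) = F x - F y := by rw [e1]; ring
    rw [e3, e2]
    ring

end Parts

/-! ### The derivative of a solution -/

/-- The right-continuous derivative of a solution with slope `c` at the origin. -/
noncomputable def solDeriv (μ : Measure ℝ) (lam c : ℝ) (u : ℝ → ℝ) (x : ℝ) : ℝ :=
  c + (∫ t in Ioc 0 x, u t ∂μ) - lam * ∫ t in Ioc 0 x, u t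

section Solution

variable {μ : Measure ℝ} {lam c : ℝ} {u : ℝ → ℝ}

theorem IsVolterraSol.zero (hu : IsVolterraSol μ lam c u) : u 0 = 0 := by
  have h : ∀ ρ : Measure ℝ, ∫ t in Icc (0 : ℝ) 1, max (0 - t) 0 * u t ∂ρ = 0 := fun ρ => by
    refine setIntegral_eq_zero_of_forall_eq_zero fun t ht => ?_
    rw [max_eq_right (by linarith [ht.1]), zero_mul]
  rw [hu.2 0 ⟨le_rfl, zero_le_one⟩, h, h]
  simp

theorem IsVolterraSol.integrableOn (hu : IsVolterraSol μ lam c u) (ρ : Measure ℝ)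
    [IsLocallyFiniteMeasure ρ] {y x : ℝ} (hy : 0 ≤ y) (hx : x ≤ 1) :
    IntegrableOn u (Ioc y x) ρ :=
  (hu.1.integrableOn_compact isCompact_Icc).mono_set fun _ ht =>
    ⟨hy.trans ht.1.le, ht.2.trans hx⟩

theorem integral_kernel_eq_integral_Ioc {E : Type*} [NormedAddCommGroup E] [NormedSpace ℝ E]
    (ρ : Measure ℝ) {f : ℝ → E} (hf : f 0 = 0) {x : ℝ} (hx : x ∈ Icc (0 : ℝ) 1) :
    ∫ t in Icc (0 : ℝ) 1, max (x - t) 0 • f t ∂ρ = ∫ t in Ioc 0 x, (x - t) • f t ∂ρ := by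
  have h1 : ∀ t ∈ Icc (0 : ℝ) 1, max (x - t) 0 • f t
      = (Ioc 0 x).indicator (fun t => (x - t) • f t) t := fun t ht => by
    by_cases h : t ∈ Ioc 0 x
    · rw [indicator_of_mem h, max_eq_left (by linarith [h.2])]
    · rw [indicator_of_notMem h]
      rcases eq_or_lt_of_le ht.1 with h0 | h0
      · rw [← h0, hf, smul_zero]
      · have : x < t := by
          by_contra! h'
          exact h ⟨h0, h'⟩
        rw [max_eq_right (by linarith), zero_smul]
  rw [setIntegral_congr_fun measurableSet_Icc h1, setIntegral_indicator measurableSet_Ioc]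
  congr 2
  exact inter_eq_right.2 fun t ht => ⟨ht.1.le, ht.2.trans hx.2⟩

variable [IsFiniteMeasure μ]

theorem IsVolterraSol.solDeriv_eq_add (hu : IsVolterraSol μ lam c u) {y x : ℝ} (hy : 0 ≤ y)
    (hyx : y ≤ x) (hx : x ≤ 1) :
    solDeriv μ lam c u x
      = solDeriv μ lam c u y + (∫ t in Ioc y x, u t ∂μ) - lam * ∫ t in Ioc y x, u t := by
  have h : ∀ (ρ : Measure ℝ) [IsLocallyFiniteMeasure ρ],
      ∫ t in Ioc 0 x, u t ∂ρ = (∫ t in Ioc 0 y, u t ∂ρ) + ∫ t in Ioc y x, u t ∂ρ := fun ρ _ => by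
    rw [← Ioc_union_Ioc_eq_Ioc hy hyx,
      setIntegral_union (Ioc_disjoint_Ioc_of_le le_rfl) measurableSet_Ioc
        (hu.integrableOn ρ le_rfl (hyx.trans hx)) (hu.integrableOn ρ hy hx)]
  rw [solDeriv, solDeriv, h, h]
  ring

/-- Integration by parts for the derivative of a solution. -/
theorem IsVolterraSol.integral_mul_ofReal_solDeriv {𝕜 : Type*} [RCLike 𝕜]
    (hu : IsVolterraSol μ lam c u) {f F : ℝ → 𝕜} {y x : ℝ} (hy : 0 ≤ y) (hyx : y ≤ x) (hx : x ≤ 1)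
    (hf : IntervalIntegrable f volume y x) (hF : ∀ t ∈ Icc y x, F t = F y + ∫ s in y..t, f s) :
    IntervalIntegrable (fun t => f t * (solDeriv μ lam c u t : 𝕜)) volume y x ∧
      ∫ t in y..x, f t * (solDeriv μ lam c u t : 𝕜)
        = solDeriv μ lam c u x * F x - solDeriv μ lam c u y * F y
          - ((∫ t in Ioc y x, (u t : 𝕜) * F t ∂μ) - lam * ∫ t in Ioc y x, (u t : 𝕜) * F t) := by
  obtain ⟨h1, h2⟩ := integral_mul_eq_sub_of_Ioc μ hyx hf (hu.integrableOn μ hy hx).ofReal hF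
    (k := fun t => (solDeriv μ lam c u y : 𝕜) + ∫ s in Ioc y t, (u s : 𝕜) ∂μ) (fun t _ => by simp)
  obtain ⟨h3, h4⟩ := integral_mul_eq_sub_of_Ioc volume hyx hf
    (hu.integrableOn volume hy hx).ofReal hF
    (k := fun t => ∫ s in Ioc y t, (u s : 𝕜)) (fun t _ => by simp)
  have hcongr : EqOn (fun t => f t * ((solDeriv μ lam c u y : 𝕜) + ∫ s in Ioc y t, (u s : 𝕜) ∂μ)
      - lam * (f t * ∫ s in Ioc y t, (u s : 𝕜))) (fun t => f t * (solDeriv μ lam c u t : 𝕜))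
      (uIcc y x) := fun t ht => by
    rw [uIcc_of_le hyx] at ht
    simp only [hu.solDeriv_eq_add hy ht.1 (ht.2.trans hx), integral_ofReal]
    push_cast
    ring
  refine ⟨(h1.sub (h3.const_mul (lam : 𝕜))).congr (hcongr.mono uIoc_subset_uIcc), ?_⟩
  rw [← intervalIntegral.integral_congr hcongr,
    intervalIntegral.integral_sub h1 (h3.const_mul (lam : 𝕜)), intervalIntegral.integral_const_mul,
    h2, h4, hu.solDeriv_eq_add hy hyx hx]
  simp only [Ioc_self, Measure.restrict_empty, integral_zero_measure, integral_ofReal]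
  push_cast
  ring

theorem IsVolterraSol.integral_mul_solDeriv (hu : IsVolterraSol μ lam c u) {f F : ℝ → ℝ}
    {y x : ℝ} (hy : 0 ≤ y) (hyx : y ≤ x) (hx : x ≤ 1) (hf : IntervalIntegrable f volume y x)
    (hF : ∀ t ∈ Icc y x, F t = F y + ∫ s in y..t, f s) :
    IntervalIntegrable (fun t => f t * solDeriv μ lam c u t) volume y x ∧
      ∫ t in y..x, f t * solDeriv μ lam c u t
        = solDeriv μ lam c u x * F x - solDeriv μ lam c u y * F y
          - ((∫ t in Ioc y x, u t * F t ∂μ) - lam * ∫ t in Ioc y x, u t * F t) :=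
  hu.integral_mul_ofReal_solDeriv hy hyx hx hf hF

theorem IsVolterraSol.intervalIntegrable_solDeriv (hu : IsVolterraSol μ lam c u) {y x : ℝ}
    (hy : 0 ≤ y) (hyx : y ≤ x) (hx : x ≤ 1) :
    IntervalIntegrable (solDeriv μ lam c u) volume y x := by
  have := (hu.integral_mul_solDeriv hy hyx hx (f := fun _ => 1) (F := fun t => t)
    intervalIntegrable_const (fun t _ => by simp)).1
  simpa using this

theorem IsVolterraSol.eq_integral_solDeriv (hu : IsVolterraSol μ lam c u) {x : ℝ}
    (hx : x ∈ Icc (0 : ℝ) 1) : u x = ∫ t in (0 : ℝ)..x, solDeriv μ lam c u t := by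
  have h := (hu.integral_mul_solDeriv le_rfl hx.1 hx.2 (f := fun _ => 1) (F := fun t => t - x)
    intervalIntegrable_const (fun t _ => by simp; ring)).2
  simp only [one_mul] at h
  have h1 : ∀ ρ : Measure ℝ, ∫ t in Ioc 0 x, u t * (t - x) ∂ρ
      = - ∫ t in Icc (0 : ℝ) 1, max (x - t) 0 * u t ∂ρ := fun ρ => by
    have h2 := integral_kernel_eq_integral_Ioc ρ hu.zero hx
    simp only [smul_eq_mul] at h2
    rw [h2, ← integral_neg]
    congr 1; ext t; ring
  rw [h, hu.2 x hx, h1, h1]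
  simp only [solDeriv, Ioc_self, Measure.restrict_empty, integral_zero_measure]
  ring

theorem IsVolterraSol.eq_add_integral_solDeriv (hu : IsVolterraSol μ lam c u) {y x : ℝ}
    (hy : 0 ≤ y) (hyx : y ≤ x) (hx : x ≤ 1) :
    u x = u y + ∫ t in y..x, solDeriv μ lam c u t := by
  rw [hu.eq_integral_solDeriv ⟨hy.trans hyx, hx⟩, hu.eq_integral_solDeriv ⟨hy, hyx.trans hx⟩,
    intervalIntegral.integral_add_adjacent_intervals
      (hu.intervalIntegrable_solDeriv le_rfl hy (hyx.trans hx))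
      (hu.intervalIntegrable_solDeriv hy hyx hx)]

theorem continuousWithinAt_integral_Ioc (ρ : Measure ℝ) [IsLocallyFiniteMeasure ρ] {f : ℝ → ℝ}
    {x : ℝ} (hf : IntegrableOn f (Ioc 0 1) ρ) (hx : x < 1) :
    ContinuousWithinAt (fun y => ∫ t in Ioc 0 y, f t ∂ρ) (Ioi x) x := by
  have h : ∀ y ≤ (1 : ℝ), ∫ t in Ioc 0 y, f t ∂ρ
      = ∫ t in Ioc (0 : ℝ) 1, (Iic y).indicator f t ∂ρ := fun y hy => by
    rw [setIntegral_indicator measurableSet_Iic, Ioc_inter_Iic, min_eq_right hy]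
  have hev : ∀ᶠ y in 𝓝[>] x, y ≤ (1 : ℝ) :=
    nhdsWithin_le_nhds (Iic_mem_nhds hx)
  refine ContinuousWithinAt.congr_of_eventuallyEq ?_ (hev.mono h) (h x hx.le)
  refine continuousWithinAt_of_dominated (bound := fun t => ‖f t‖) ?_ ?_ hf.norm ?_
  · exact Eventually.of_forall fun y => hf.1.indicator measurableSet_Iic
  · exact Eventually.of_forall fun y => Eventually.of_forall fun t => norm_indicator_le_norm_self _ _
  · refine Eventually.of_forall fun t => ?_
    rcases le_or_gt t x with htx | htx
    · refine ContinuousWithinAt.congr_of_eventuallyEq (f := fun _ => f t)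
        continuousWithinAt_const ?_ (by simp [htx])
      filter_upwards [self_mem_nhdsWithin] with y hy
      simp [htx.trans (le_of_lt hy)]
    · refine ContinuousWithinAt.congr_of_eventuallyEq (f := fun _ => (0 : ℝ))
        continuousWithinAt_const ?_ (by simp [htx])
      filter_upwards [nhdsWithin_le_nhds (Iio_mem_nhds htx)] with y hy
      simp [mem_Iio.1 hy]

/-- The function `solDeriv` is the right derivative of the solution. -/
theorem IsVolterraSol.hasDerivWithinAt (hu : IsVolterraSol μ lam c u) {x : ℝ} (hx : 0 ≤ x)
    (hx1 : x < 1) : HasDerivWithinAt u (solDeriv μ lam c u x) (Ici x) x := by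
  have hcont : ContinuousWithinAt (solDeriv μ lam c u) (Ioi x) x := by
    unfold solDeriv
    exact (continuousWithinAt_const.add
      (continuousWithinAt_integral_Ioc μ (hu.integrableOn μ le_rfl le_rfl) hx1)).sub
      (continuousWithinAt_const.mul
      (continuousWithinAt_integral_Ioc volume (hu.integrableOn volume le_rfl le_rfl) hx1))
  have hmeas : StronglyMeasurableAtFilter (solDeriv μ lam c u) (𝓝[>] x) volume :=
    ⟨Ioc x 1, Ioc_mem_nhdsGT hx1, (hu.intervalIntegrable_solDeriv hx hx1.le le_rfl).1.1⟩
  have h := intervalIntegral.integral_hasDerivWithinAt_right (s := Ici x) (t := Ioi x)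
    (hu.intervalIntegrable_solDeriv le_rfl hx hx1.le) hmeas hcont
  refine h.congr_of_eventuallyEq ?_ (hu.eq_integral_solDeriv ⟨hx, hx1.le⟩)
  filter_upwards [Icc_mem_nhdsGE hx1] with y hy
  exact hu.eq_integral_solDeriv ⟨hx.trans hy.1, hy.2⟩

theorem hasDerivWithinAt_Ici_nonneg {f : ℝ → ℝ} {f' x y : ℝ} (hxy : x < y)
    (hf : HasDerivWithinAt f f' (Ici x) x) (h : ∀ t ∈ Icc x y, f x ≤ f t) : 0 ≤ f' := by
  have h1 := (hasDerivWithinAt_iff_tendsto_slope' (by simp)).1 hf.Ioi_of_Ici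
  refine ge_of_tendsto h1 ?_
  filter_upwards [Ioc_mem_nhdsGT hxy] with t ht
  rw [slope_def_field]
  exact div_nonneg (by linarith [h t (Ioc_subset_Icc_self ht)]) (by linarith [ht.1])

theorem hasDerivWithinAt_Ici_nonpos {f : ℝ → ℝ} {f' x y : ℝ} (hxy : x < y)
    (hf : HasDerivWithinAt f f' (Ici x) x) (h : ∀ t ∈ Icc x y, f t ≤ f x) : f' ≤ 0 := by
  have := hasDerivWithinAt_Ici_nonneg hxy hf.neg (fun t ht => neg_le_neg (h t ht))
  linarith

end Solution

/-! ### Growth and positivity of solutions -/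

section Growth

variable {μ : Measure ℝ} {lam c : ℝ} {u : ℝ → ℝ}

theorem IsVolterraSol.exists_bound (hu : IsVolterraSol μ lam c u) :
    ∃ B, 0 ≤ B ∧ ∀ t ∈ Icc (0 : ℝ) 1, |u t| ≤ B := by
  obtain ⟨B, hB⟩ := isCompact_Icc.exists_bound_of_continuousOn hu.1
  exact ⟨B, (norm_nonneg _).trans (hB 0 ⟨le_rfl, zero_le_one⟩), hB⟩

variable [IsFiniteMeasure μ]

theorem IsVolterraSol.abs_sub_le_pow (hu : IsVolterraSol μ lam c u) {A x : ℝ} (hA : 0 ≤ A) (n : ℕ)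
    (h : ∀ t ∈ Icc (0 : ℝ) 1, |u t| ≤ A * t ^ n) (hx : x ∈ Icc (0 : ℝ) 1) :
    |u x - c * x| ≤ A * (μ.real (Icc 0 1) + |lam|) * x ^ (n + 1) := by
  have hx0 := hx.1
  have h1 := abs_integral_kernel_le μ hx hA n (fun t ht _ => h t ht)
  have h2 := abs_integral_kernel_le volume hx hA n (fun t ht _ => h t ht)
  have hvol : (volume : Measure ℝ).real (Icc 0 1) = 1 := by simp
  rw [hvol, mul_one] at h2
  have h3 : x ^ (n + 1) / ((n : ℝ) + 1) ≤ x ^ (n + 1) :=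
    div_le_self (by positivity) (by linarith [(Nat.cast_nonneg n : (0 : ℝ) ≤ n)])
  have h4 : A * (x ^ (n + 1) / ((n : ℝ) + 1)) ≤ A * x ^ (n + 1) :=
    mul_le_mul_of_nonneg_left h3 hA
  have h5 : (0 : ℝ) ≤ μ.real (Icc 0 1) := measureReal_nonneg
  rw [hu.2 x hx]
  calc |c * x + (∫ t in Icc (0 : ℝ) 1, max (x - t) 0 * u t ∂μ)
        - lam * (∫ t in Icc (0 : ℝ) 1, max (x - t) 0 * u t) - c * x|
      = |(∫ t in Icc (0 : ℝ) 1, max (x - t) 0 * u t ∂μ)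
        - lam * ∫ t in Icc (0 : ℝ) 1, max (x - t) 0 * u t| := by congr 1; ring
    _ ≤ A * x ^ (n + 1) * μ.real (Icc 0 1) + |lam| * (A * x ^ (n + 1)) := by
        refine (abs_sub _ _).trans ?_
        rw [abs_mul]
        exact add_le_add (h1.trans (mul_le_mul_of_nonneg_right h4 h5))
          (mul_le_mul_of_nonneg_left (h2.trans h4) (abs_nonneg _))
    _ = A * (μ.real (Icc 0 1) + |lam|) * x ^ (n + 1) := by ring

theorem IsVolterraSol.abs_le_mul (hu : IsVolterraSol μ lam c u) {B x : ℝ} (hB : 0 ≤ B)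
    (h : ∀ t ∈ Icc (0 : ℝ) 1, |u t| ≤ B) (hx : x ∈ Icc (0 : ℝ) 1) :
    |u x| ≤ (|c| + B * (μ.real (Icc 0 1) + |lam|)) * x := by
  have h1 := hu.abs_sub_le_pow hB 0 (fun t ht => by simpa using h t ht) hx
  have h2 : |u x| ≤ |u x - c * x| + |c * x| := by
    simpa using abs_add_le (u x - c * x) (c * x)
  rw [abs_mul, abs_of_nonneg hx.1] at h2
  simp only [zero_add, pow_one] at h1
  linarith

/-- A solution is linear near the origin up to a quadratic error, uniformly in its sup norm. -/
theorem IsVolterraSol.abs_sub_le_sq (hu : IsVolterraSol μ lam c u) {B x : ℝ} (hB : 0 ≤ B)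
    (h : ∀ t ∈ Icc (0 : ℝ) 1, |u t| ≤ B) (hx : x ∈ Icc (0 : ℝ) 1) :
    |u x - c * x| ≤ (|c| + B * (μ.real (Icc 0 1) + |lam|)) * (μ.real (Icc 0 1) + |lam|)
      * x ^ 2 := by
  have hN : (0 : ℝ) ≤ μ.real (Icc 0 1) + |lam| := by positivity
  exact hu.abs_sub_le_pow (by positivity) 1 (fun t ht => by simpa using hu.abs_le_mul hB h ht) hx

variable (μ)

/-- Solutions with slope `1` are positive on a neighbourhood of the origin which is uniform for
`lam` in a compact interval. -/
theorem exists_shoot_pos_near_zero (a b : ℝ) :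
    ∃ δ, 0 < δ ∧ δ ≤ 1 ∧ ∀ lam ∈ Icc a b, ∀ x, 0 < x → x ≤ δ → 0 < shoot μ lam x := by
  obtain ⟨B₀, hB₀⟩ := (isCompact_Icc (a := a) (b := b)).prod
    (isCompact_Icc (a := (0 : ℝ)) (b := 1)) |>.exists_bound_of_continuousOn
    (continuous_shoot_uncurry μ).continuousOn
  set B := max B₀ 0 with hB
  set N := μ.real (Icc (0 : ℝ) 1) + (|a| + |b|) with hN
  have hN0 : 0 ≤ N := by positivity
  have hB0 : 0 ≤ B := le_max_right _ _
  set K := (1 + B * N) * N with hK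
  have hK0 : 0 ≤ K := by positivity
  -- Here `u x ≥ x - K x ^ 2`, which is positive for `x ≤ 1 / (K + 1)`.
  refine ⟨1 / (K + 1), by positivity, (div_le_one (by positivity)).2 (by linarith), ?_⟩
  intro lam hlam x hx hxδ
  have hx1 : x ≤ 1 := hxδ.trans ((div_le_one (by positivity)).2 (by linarith))
  have habs : |lam| ≤ |a| + |b| := by
    rcases abs_cases lam with h | h <;> rcases abs_cases a with h' | h' <;>
      rcases abs_cases b with h'' | h'' <;> linarith [hlam.1, hlam.2]
  have h1 := (isVolterraSol_shoot μ lam).abs_sub_le_sq hB0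
    (fun t ht => (hB₀ (lam, t) ⟨hlam, ht⟩).trans (le_max_left _ _)) ⟨hx.le, hx1⟩
  have h2 : μ.real (Icc (0 : ℝ) 1) + |lam| ≤ N := by linarith
  have h3 : (|(1 : ℝ)| + B * (μ.real (Icc 0 1) + |lam|)) * (μ.real (Icc 0 1) + |lam|) * x ^ 2
      ≤ K * x ^ 2 := by
    rw [abs_one, hK]
    gcongr
  have h4 : (K + 1) * x ≤ 1 := by
    rw [le_div_iff₀ (by positivity)] at hxδ
    linarith
  have h5 := (abs_le.1 (h1.trans h3)).1
  nlinarith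

/-- A solution which is not positive on all of `(0,1]` has a first zero. -/
theorem exists_first_zero_shoot {x : ℝ} (hx : x ∈ Ioc (0 : ℝ) 1) (h : shoot μ lam x ≤ 0) :
    ∃ y ∈ Ioc (0 : ℝ) 1, y ≤ x ∧ shoot μ lam y = 0 ∧ ∀ t ∈ Ioo 0 y, 0 < shoot μ lam t := by
  obtain ⟨δ, hδ, -, hpos⟩ := exists_shoot_pos_near_zero μ lam lam
  have hpos' := hpos lam ⟨le_rfl, le_rfl⟩
  have hδx : δ ≤ x := by
    by_contra! h'
    exact absurd (hpos' x hx.1 h'.le) (not_lt.2 h)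
  have hcpt : IsCompact (Icc δ x ∩ {t | shoot μ lam t ≤ 0}) :=
    isCompact_Icc.inter_right (isClosed_le (continuous_shoot μ lam) continuous_const)
  obtain ⟨y, ⟨hyI, hy0⟩, hymin⟩ := hcpt.exists_isLeast ⟨x, ⟨hδx, le_rfl⟩, h⟩
  have hbefore : ∀ t ∈ Ioo 0 y, 0 < shoot μ lam t := fun t ht => by
    rcases le_total t δ with h' | h'
    · exact hpos' t ht.1 h'
    · by_contra! h''
      exact absurd (hymin ⟨⟨h', ht.2.le.trans hyI.2⟩, h''⟩) (not_le.2 ht.2)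
  have hy : 0 < y := hδ.trans_le hyI.1
  refine ⟨y, ⟨hy, hyI.2.trans hx.2⟩, hyI.2, le_antisymm hy0 ?_, hbefore⟩
  have hcl : y ∈ closure (Ioo 0 y) := by
    rw [closure_Ioo hy.ne]
    exact ⟨hy.le, le_rfl⟩
  exact closure_minimal (fun t ht => (hbefore t ht).le)
    (isClosed_le continuous_const (continuous_shoot μ lam)) hcl

/-- For `lam ≤ 0` the kernel term of the Volterra equation is nonnegative up to the first zero,
so that there is none. -/
theorem shoot_pos_of_nonpos (hlam : lam ≤ 0) {x : ℝ} (hx : x ∈ Ioc (0 : ℝ) 1) :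
    0 < shoot μ lam x := by
  by_contra! h
  obtain ⟨y, hy, -, hy0, hpos⟩ := exists_first_zero_shoot μ hx h
  have hsol := isVolterraSol_shoot μ lam
  have hnn : ∀ ρ : Measure ℝ,
      0 ≤ ∫ t in Icc (0 : ℝ) 1, max (y - t) 0 * shoot μ lam t ∂ρ := fun ρ => by
    refine setIntegral_nonneg measurableSet_Icc fun t ht => ?_
    rcases le_or_gt y t with h' | h'
    · rw [max_eq_right (by linarith), zero_mul]
    · refine mul_nonneg (le_max_right _ _) ?_
      rcases eq_or_lt_of_le ht.1 with h0 | h0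
      · rw [← h0, hsol.zero]
      · exact (hpos t ⟨h0, h'⟩).le
  have h1 := hsol.2 y ⟨hy.1.le, hy.2⟩
  nlinarith [hnn μ, hnn volume, hy.1]

variable {μ}

/-- A nonnegative solution vanishing at an interior point vanishes identically on an interval
to the left of it: its derivative at the zero is nonnegative, and before the zero it
differs from this value by at most a multiple of the maximum of the solution. -/
theorem IsVolterraSol.eq_zero_left_of_interior_zero (hu : IsVolterraSol μ lam c u)
    (hnn : ∀ t ∈ Icc (0 : ℝ) 1, 0 ≤ u t) {x : ℝ} (hx : x ∈ Ioo (0 : ℝ) 1) (hux : u x = 0) :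
    ∃ y ∈ Ioo 0 x, u y = 0 := by
  set N := μ.real (Icc (0 : ℝ) 1) + |lam| with hN
  have hN0 : 0 ≤ N := by positivity
  -- On an interval of length `ε` with `ε N ≤ 1 / 2` the supremum of `u` is at most half of itself.
  set ε := min (x / 2) (1 / (2 * (N + 1))) with hε
  have hε0 : 0 < ε := lt_min (by linarith [hx.1]) (by positivity)
  have hεx : ε < x := (min_le_left _ _).trans_lt (by linarith [hx.1])
  have hεN : ε * N ≤ 1 / 2 := by
    have h1 : ε * (N + 1) ≤ 1 / (2 * (N + 1)) * (N + 1) :=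
      mul_le_mul_of_nonneg_right (min_le_right _ _) (by positivity)
    have h2 : 1 / (2 * (N + 1)) * (N + 1) = 1 / 2 := by field_simp
    nlinarith
  have hsub : Icc (x - ε) x ⊆ Icc 0 1 := Icc_subset_Icc (by linarith) hx.2.le
  have hd : 0 ≤ solDeriv μ lam c u x :=
    hasDerivWithinAt_Ici_nonneg hx.2 (hu.hasDerivWithinAt hx.1.le hx.2) fun t ht => by
      rw [hux]
      exact hnn t ⟨hx.1.le.trans ht.1, ht.2⟩
  obtain ⟨z, hz, hzmax⟩ := isCompact_Icc.exists_isMaxOn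
    (nonempty_Icc.2 (by linarith : x - ε ≤ x)) (hu.1.mono hsub)
  have hS0 : 0 ≤ u z := hnn z (hsub hz)
  have hslope : ∀ t ∈ Icc (x - ε) x, -(N * u z) ≤ solDeriv μ lam c u t := fun t ht => by
    have h1 := hu.solDeriv_eq_add (hsub ht).1 ht.2 hx.2.le
    have hb : ∀ (ρ : Measure ℝ) [IsLocallyFiniteMeasure ρ],
        |∫ s in Ioc t x, u s ∂ρ| ≤ u z * ρ.real (Icc 0 1) := fun ρ _ => by
      have hfin : ρ (Icc 0 1) < ⊤ := isCompact_Icc.measure_lt_top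
      have hss : Ioc t x ⊆ Icc 0 1 := fun s hs => ⟨(hsub ht).1.trans hs.1.le, hs.2.trans hx.2.le⟩
      have h2 : ‖∫ s in Ioc t x, u s ∂ρ‖ ≤ u z * ρ.real (Ioc t x) :=
        norm_setIntegral_le_of_norm_le_const ((measure_mono hss).trans_lt hfin) fun s hs => by
          have hs' : s ∈ Icc (x - ε) x := ⟨ht.1.trans hs.1.le, hs.2⟩
          rw [Real.norm_eq_abs, abs_of_nonneg (hnn s (hsub hs'))]
          exact hzmax hs'
      exact h2.trans (mul_le_mul_of_nonneg_left (measureReal_mono hss hfin.ne) hS0)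
    have h3 := hb μ
    have h4 := hb volume
    have hvol : (volume : Measure ℝ).real (Icc 0 1) = 1 := by simp
    rw [hvol, mul_one] at h4
    have h5 : lam * (∫ s in Ioc t x, u s) ≥ -(|lam| * u z) := by
      have h6 := neg_abs_le (lam * ∫ s in Ioc t x, u s)
      rw [abs_mul] at h6
      linarith [mul_le_mul_of_nonneg_left h4 (abs_nonneg lam)]
    have h7 := (abs_le.1 h3).2
    have h8 : N * u z = u z * μ.real (Icc 0 1) + |lam| * u z := by rw [hN]; ring
    linarith
  have hzle : u z ≤ ε * (N * u z) := by
    have h1 := hu.eq_add_integral_solDeriv (hsub hz).1 hz.2 hx.2.le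
    have h2 : (∫ _ in z..x, -(N * u z)) ≤ ∫ t in z..x, solDeriv μ lam c u t :=
      intervalIntegral.integral_mono_on hz.2 intervalIntegrable_const
        (hu.intervalIntegrable_solDeriv (hsub hz).1 hz.2 hx.2.le)
        fun t ht => hslope t ⟨hz.1.trans ht.1, ht.2⟩
    rw [intervalIntegral.integral_const, smul_eq_mul] at h2
    have h3 : (x - z) * (N * u z) ≤ ε * (N * u z) :=
      mul_le_mul_of_nonneg_right (by linarith [hz.1]) (by positivity)
    linarith
  have hz0 : u z = 0 := by nlinarith
  refine ⟨x - ε, ⟨by linarith, by linarith⟩, le_antisymm ?_ (hnn _ (hsub ⟨le_rfl, by linarith⟩))⟩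
  exact (hzmax (a := x - ε) ⟨le_rfl, by linarith⟩).trans hz0.le

end Growth

/-! ### Zeros of the shooting function -/

section Zeros

variable {μ : Measure ℝ} [IsFiniteMeasure μ]

/-- Comparison of a solution with the sine function. -/
theorem IsVolterraSol.mul_eq_sin_add {k c : ℝ} {u : ℝ → ℝ} (hu : IsVolterraSol μ (k ^ 2) c u)
    {x : ℝ} (hx : x ∈ Icc (0 : ℝ) 1) :
    k * u x = c * Real.sin (k * x) + ∫ t in Ioc 0 x, u t * Real.sin (k * (x - t)) ∂μ := by
  have hdF : ∀ t, HasDerivAt (fun t => Real.sin (k * (x - t))) (-k * Real.cos (k * (x - t))) t :=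
    fun t => by
      have h1 : HasDerivAt (fun t => k * (x - t)) (k * (-1)) t :=
        ((hasDerivAt_id t).const_sub x).const_mul k
      exact h1.sin.congr_deriv (by ring)
  have hdf : ∀ t, HasDerivAt (fun t => -k * Real.cos (k * (x - t)))
      (-(k ^ 2) * Real.sin (k * (x - t))) t := fun t => by
    have h1 : HasDerivAt (fun t => k * (x - t)) (k * (-1)) t :=
      ((hasDerivAt_id t).const_sub x).const_mul k
    exact (h1.cos.const_mul (-k)).congr_deriv (by ring)
  have hf : Continuous fun t => -k * Real.cos (k * (x - t)) := by fun_prop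
  have hh : Continuous fun t => -(k ^ 2) * Real.sin (k * (x - t)) := by fun_prop
  have h1 := (hu.integral_mul_solDeriv le_rfl hx.1 hx.2 (hf.intervalIntegrable 0 x)
    (F := fun t => Real.sin (k * (x - t))) (fun t _ => by
      rw [intervalIntegral.integral_eq_sub_of_hasDerivAt (fun s _ => hdF s)
        (hf.intervalIntegrable _ _)]
      ring)).2
  have h2 := (integral_mul_eq_sub_of_Ioc volume hx.1
    (hu.intervalIntegrable_solDeriv le_rfl hx.1 hx.2)
    (hh.integrableOn_Ioc) (F := u) (k := fun t => -k * Real.cos (k * (x - t)))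
    (fun t ht => hu.eq_add_integral_solDeriv le_rfl ht.1 (ht.2.trans hx.2)) (fun t ht => by
      rw [← intervalIntegral.integral_of_le ht.1,
        intervalIntegral.integral_eq_sub_of_hasDerivAt (fun s _ => hdf s)
        (hh.intervalIntegrable _ _)]
      ring)).2
  have h3 : (∫ t in (0 : ℝ)..x, solDeriv μ (k ^ 2) c u t * (-k * Real.cos (k * (x - t))))
      = ∫ t in (0 : ℝ)..x, -k * Real.cos (k * (x - t)) * solDeriv μ (k ^ 2) c u t := by
    congr 1; ext t; ring
  have h4 : (∫ t in Ioc 0 x, -(k ^ 2) * Real.sin (k * (x - t)) * u t)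
      = -(k ^ 2) * ∫ t in Ioc 0 x, u t * Real.sin (k * (x - t)) := by
    rw [← integral_const_mul]
    congr 1; ext t; ring
  have h5 : solDeriv μ (k ^ 2) c u 0 = c := by simp [solDeriv]
  rw [h3, h1, h4, h5, hu.zero] at h2
  simp only [sub_self, mul_zero, Real.sin_zero, Real.cos_zero, sub_zero, zero_sub, mul_one,
    neg_mul] at h2
  linarith

/-- For `k` larger than twice the mass of the potential, the comparison with the sine first bounds
the supremum of the solution by `2 / k`, and then its deviation from the sine. -/
theorem abs_mul_shoot_one_sub_sin_lt {k : ℝ} (hk0 : 0 < k) (hk : 2 * μ.real (Icc 0 1) < k) :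
    |k * shoot μ (k ^ 2) 1 - Real.sin k| < 1 := by
  set u := shoot μ (k ^ 2) with hu'
  set M := μ.real (Icc (0 : ℝ) 1) with hM
  have hM0 : 0 ≤ M := measureReal_nonneg
  have hu : IsVolterraSol μ (k ^ 2) 1 u := isVolterraSol_shoot μ (k ^ 2)
  obtain ⟨z, hz, hzmax⟩ := isCompact_Icc.exists_isMaxOn
    (nonempty_Icc.2 (zero_le_one (α := ℝ))) hu.1.abs
  have hzmax' : ∀ t ∈ Icc (0 : ℝ) 1, |u t| ≤ |u z| := fun t ht => hzmax ht
  have hint : ∀ x ∈ Icc (0 : ℝ) 1,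
      |∫ t in Ioc 0 x, u t * Real.sin (k * (x - t)) ∂μ| ≤ |u z| * M := fun x hx => by
    have hss : Ioc 0 x ⊆ Icc 0 1 := fun s hs => ⟨hs.1.le, hs.2.trans hx.2⟩
    have h2 : ‖∫ t in Ioc 0 x, u t * Real.sin (k * (x - t)) ∂μ‖ ≤ |u z| * μ.real (Ioc 0 x) :=
      norm_setIntegral_le_of_norm_le_const (measure_lt_top _ _) fun s hs => by
        rw [Real.norm_eq_abs, abs_mul]
        exact (mul_le_of_le_one_right (abs_nonneg _) (Real.abs_sin_le_one _)).trans
          (hzmax' s (hss hs))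
    exact h2.trans (mul_le_mul_of_nonneg_left (measureReal_mono hss) (abs_nonneg _))
  have hB : k * |u z| ≤ 1 + |u z| * M := by
    have h1 := hu.mul_eq_sin_add hz
    rw [one_mul] at h1
    rw [← abs_of_pos hk0, ← abs_mul, h1]
    exact (abs_add_le _ _).trans (add_le_add (Real.abs_sin_le_one _) (hint z hz))
  have h1 := hu.mul_eq_sin_add (x := 1) ⟨zero_le_one, le_rfl⟩
  rw [one_mul, mul_one] at h1
  rw [h1, add_sub_cancel_left]
  refine (hint 1 ⟨zero_le_one, le_rfl⟩).trans_lt ?_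
  rcases (abs_nonneg (u z)).eq_or_lt with h0 | h0
  · rw [← h0, zero_mul]; exact one_pos
  · nlinarith

variable (μ) in
theorem continuous_shoot_left (x : ℝ) : Continuous fun lam => shoot μ lam x :=
  Continuous.comp (g := fun p : ℝ × ℝ => shoot μ p.1 p.2) (f := fun lam => (lam, x))
    (continuous_shoot_uncurry μ) (by fun_prop)

variable (μ) in
/-- There are arbitrarily large Dirichlet eigenvalues: for large `k` the sign of the solution with
`lam = k ^ 2` at the right end point is that of `sin k` when `sin k = ± 1`. -/
theorem exists_shoot_one_eq_zero_gt (R : ℝ) : ∃ lam, R < lam ∧ shoot μ lam 1 = 0 := by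
  obtain ⟨n, hn⟩ := exists_nat_gt (max R (2 * μ.real (Icc (0 : ℝ) 1)))
  have hn1 := (le_max_left _ _).trans_lt hn
  have hn2 := (le_max_right _ _).trans_lt hn
  have hpi := Real.pi_gt_three
  have hn0 : (0 : ℝ) ≤ n := Nat.cast_nonneg n
  set k : ℝ := Real.pi / 2 + n * (2 * Real.pi) with hk
  have hkn : (n : ℝ) + 1 ≤ k := by nlinarith
  have hsin : Real.sin k = 1 := by
    rw [hk, Real.sin_add_nat_mul_two_pi, Real.sin_pi_div_two]
  have hsin' : Real.sin (k + Real.pi) = -1 := by rw [Real.sin_add_pi, hsin]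
  have h1 := abs_mul_shoot_one_sub_sin_lt (μ := μ) (k := k) (by linarith) (by linarith)
  have h2 := abs_mul_shoot_one_sub_sin_lt (μ := μ) (k := k + Real.pi) (by linarith) (by linarith)
  rw [hsin, abs_lt] at h1
  rw [hsin', abs_lt] at h2
  have hpos : 0 ≤ shoot μ (k ^ 2) 1 := by
    by_contra! h
    nlinarith
  have hneg : shoot μ ((k + Real.pi) ^ 2) 1 ≤ 0 := by
    by_contra! h
    nlinarith
  have hle : k ^ 2 ≤ (k + Real.pi) ^ 2 := by nlinarith
  obtain ⟨lam, hlam, h0⟩ := intermediate_value_Icc' hle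
    (continuous_shoot_left μ 1).continuousOn ⟨hneg, hpos⟩
  exact ⟨lam, by nlinarith [hlam.1], h0⟩

variable (μ) in
/-- The lowest Dirichlet eigenvalue is positive, and the corresponding solution has no zero
inside the interval. It is obtained as the least `lam ≥ 0` whose solution is not positive on all
of `(0,1]`. -/
theorem exists_ground_state : ∃ e : ℝ, 0 < e ∧ shoot μ e 1 = 0 ∧
    (∀ x ∈ Ioo (0 : ℝ) 1, 0 < shoot μ e x) ∧ ∀ lam < e, shoot μ lam 1 ≠ 0 := by
  obtain ⟨b, hb, hb0⟩ := exists_shoot_one_eq_zero_gt μ 0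
  obtain ⟨δ, hδ, hδ1, hpos⟩ := exists_shoot_pos_near_zero μ 0 b
  have hcpt : IsCompact ((Icc 0 b ×ˢ Icc δ 1) ∩ {p : ℝ × ℝ | shoot μ p.1 p.2 ≤ 0}) :=
    (isCompact_Icc.prod isCompact_Icc).inter_right
      (isClosed_le (continuous_shoot_uncurry μ) continuous_const)
  obtain ⟨⟨e, x⟩, ⟨⟨he, hx⟩, hex⟩, hmin⟩ := hcpt.exists_isMinOn
    ⟨(b, 1), ⟨⟨hb.le, le_rfl⟩, ⟨hδ1, le_rfl⟩⟩, hb0.le⟩ continuous_fst.continuousOn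
  simp only at he hx hex
  have hx0 : 0 < x := hδ.trans_le hx.1
  have he0 : 0 < e := by
    by_contra! h
    exact absurd (shoot_pos_of_nonpos μ h ⟨hx0, hx.2⟩) (not_lt.2 hex)
  have hbelow : ∀ lam < e, ∀ t ∈ Ioc (0 : ℝ) 1, 0 < shoot μ lam t := fun lam hlam t ht => by
    rcases le_total lam 0 with h | h
    · exact shoot_pos_of_nonpos μ h ht
    rcases le_total t δ with h' | h'
    · exact hpos lam ⟨h, hlam.le.trans he.2⟩ t ht.1 h'
    by_contra! h''
    have h3 := hmin (a := (lam, t)) ⟨⟨⟨h, hlam.le.trans he.2⟩, ⟨h', ht.2⟩⟩, h''⟩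
    exact absurd (show e ≤ lam from h3) (not_le.2 hlam)
  have hnn : ∀ t ∈ Icc (0 : ℝ) 1, 0 ≤ shoot μ e t := fun t ht => by
    rcases eq_or_lt_of_le ht.1 with h0 | h0
    · rw [← h0, (isVolterraSol_shoot μ e).zero]
    · have hcl : e ∈ closure (Iio e) := by simp
      exact closure_minimal (s := Iio e) (t := {lam | 0 ≤ shoot μ lam t})
        (fun lam hlam => (hbelow lam hlam t ⟨h0, ht.2⟩).le)
        (isClosed_le continuous_const (continuous_shoot_left μ t)) hcl
  obtain ⟨y, hy, -, hy0, hypos⟩ := exists_first_zero_shoot μ ⟨hx0, hx.2⟩ hex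
  -- The first zero of the nonnegative limit solution cannot be an interior point.
  have hy1 : y = 1 := by
    by_contra h
    obtain ⟨w, hw, hw0⟩ := (isVolterraSol_shoot μ e).eq_zero_left_of_interior_zero hnn
      ⟨hy.1, lt_of_le_of_ne hy.2 h⟩ hy0
    exact (hypos w hw).ne' hw0
  subst hy1
  exact ⟨e, he0, hy0, hypos, fun lam hlam => (hbelow lam hlam 1 ⟨one_pos, le_rfl⟩).ne'⟩

end Zeros

/-! ### A Harnack inequality for positive solutions -/

section Harnack

variable {μ : Measure ℝ} [IsFiniteMeasure μ] {a c : ℝ} {u : ℝ → ℝ}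

/-- Since `(u'/u)' = μ - a - (u'/u)²`, the integral of `(u'/u)²` between a point where `u` does not
increase and a later point where it does not decrease is at most the mass of `μ`. Together with
`-u'/u ≤ κ/2 + (u'/u)²/(2κ)` this controls the decay of `log u`. -/
theorem IsVolterraSol.le_exp_mul_of_solDeriv_sign (hu : IsVolterraSol μ a c u) (ha : 0 ≤ a)
    (hpos : ∀ x ∈ Ioo (0 : ℝ) 1, 0 < u x) {κ s y : ℝ} (hκ : 0 < κ) (hs : 0 < s) (hsy : s ≤ y)
    (hy : y < 1) (hus : solDeriv μ a c u s ≤ 0) (huy : 0 ≤ solDeriv μ a c u y) :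
    u s ≤ Real.exp ((κ + μ.real (Icc 0 1) / κ) / 2) * u y := by
  have hmem : ∀ t ∈ Icc s y, t ∈ Ioo (0 : ℝ) 1 := fun t ht =>
    ⟨hs.trans_le ht.1, ht.2.trans_lt hy⟩
  have hpos' : ∀ t ∈ Icc s y, 0 < u t := fun t ht => hpos t (hmem t ht)
  have hne : ∀ t ∈ Icc s y, u t ≠ 0 := fun t ht => (hpos' t ht).ne'
  have hcont : ContinuousOn u (Icc s y) := hu.1.mono fun t ht => Ioo_subset_Icc_self (hmem t ht)
  have hderiv : ∀ t ∈ Icc s y, HasDerivWithinAt u (solDeriv μ a c u t) (Ioi t) t := fun t ht =>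
    (hu.hasDerivWithinAt (hmem t ht).1.le (hmem t ht).2).Ioi_of_Ici
  have hint := hu.intervalIntegrable_solDeriv hs.le hsy hy.le
  have hcinv : ContinuousOn (fun t => (u t)⁻¹) (Icc s y) := hcont.inv₀ hne
  have hq : IntervalIntegrable (fun t => (u t)⁻¹ * solDeriv μ a c u t) volume s y :=
    hint.continuousOn_mul (by rwa [uIcc_of_le hsy])
  have hf : IntervalIntegrable (fun t => -(u t)⁻¹ ^ 2 * solDeriv μ a c u t) volume s y :=
    hint.continuousOn_mul (by rw [uIcc_of_le hsy]; exact (hcinv.pow 2).neg)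
  obtain ⟨h1, h2⟩ := hu.integral_mul_solDeriv hs.le hsy hy.le hf (F := fun t => (u t)⁻¹)
    (fun t ht => by
      have hst : Icc s t ⊆ Icc s y := Icc_subset_Icc_right ht.2
      rw [intervalIntegral.integral_eq_sub_of_hasDeriv_right (f := fun t => (u t)⁻¹)]
      · ring
      · rw [uIcc_of_le ht.1]; exact hcinv.mono hst
      · intro r hr
        rw [min_eq_left ht.1, max_eq_right ht.1] at hr
        have hr' := hst (Ioo_subset_Icc_self hr)
        exact ((hderiv r hr').inv (hne r hr')).congr_deriv (by field_simp)
      · exact hf.mono_set (by rw [uIcc_of_le hsy, uIcc_of_le ht.1]; exact hst))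
  have hone : ∀ (ρ : Measure ℝ), ∫ t in Ioc s y, u t * (u t)⁻¹ ∂ρ = ρ.real (Ioc s y) :=
    fun ρ => by
      rw [setIntegral_congr_fun (g := fun _ => (1 : ℝ)) measurableSet_Ioc
        (fun t ht => mul_inv_cancel₀ (hne t (Ioc_subset_Icc_self ht)))]
      simp
  rw [hone, hone] at h2
  have hM : μ.real (Ioc s y) ≤ μ.real (Icc 0 1) :=
    measureReal_mono fun t ht => Ioo_subset_Icc_self (hmem t (Ioc_subset_Icc_self ht))
  have h3 : 0 ≤ solDeriv μ a c u y * (u y)⁻¹ :=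
    mul_nonneg huy (inv_nonneg.2 (hpos' y ⟨hsy, le_rfl⟩).le)
  have h4 : solDeriv μ a c u s * (u s)⁻¹ ≤ 0 :=
    mul_nonpos_of_nonpos_of_nonneg hus (inv_nonneg.2 (hpos' s ⟨le_rfl, hsy⟩).le)
  have h5 : 0 ≤ a * (volume : Measure ℝ).real (Ioc s y) := mul_nonneg ha measureReal_nonneg
  have hsq : -μ.real (Icc 0 1)
      ≤ ∫ t in s..y, -(u t)⁻¹ ^ 2 * solDeriv μ a c u t * solDeriv μ a c u t := by
    rw [h2]
    linarith
  have hlog : ∫ t in s..y, (u t)⁻¹ * solDeriv μ a c u t = Real.log (u y) - Real.log (u s) := by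
    refine intervalIntegral.integral_eq_sub_of_hasDeriv_right (f := fun t => Real.log (u t)) ?_ ?_ hq
    · rw [uIcc_of_le hsy]; exact hcont.log hne
    · intro r hr
      rw [min_eq_left hsy, max_eq_right hsy] at hr
      have hr' := Ioo_subset_Icc_self hr
      exact ((hderiv r hr').log (hne r hr')).congr_deriv (by field_simp)
  have hmono : ∫ t in s..y, (-(κ / 2)
        + 1 / (2 * κ) * (-(u t)⁻¹ ^ 2 * solDeriv μ a c u t * solDeriv μ a c u t))
      ≤ ∫ t in s..y, (u t)⁻¹ * solDeriv μ a c u t := by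
    refine intervalIntegral.integral_mono_on hsy (intervalIntegrable_const.add (h1.const_mul _)) hq
      fun t _ => ?_
    have h6 : 0 ≤ (κ + (u t)⁻¹ * solDeriv μ a c u t) ^ 2 / (2 * κ) := by positivity
    have h7 : (u t)⁻¹ * solDeriv μ a c u t - (-(κ / 2)
        + 1 / (2 * κ) * (-(u t)⁻¹ ^ 2 * solDeriv μ a c u t * solDeriv μ a c u t))
        = (κ + (u t)⁻¹ * solDeriv μ a c u t) ^ 2 / (2 * κ) := by
      field_simp
      ring
    linarith
  rw [intervalIntegral.integral_add intervalIntegrable_const (h1.const_mul _),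
    intervalIntegral.integral_const_mul, intervalIntegral.integral_const, smul_eq_mul, hlog]
    at hmono
  have h8 : 1 / (2 * κ) * (-μ.real (Icc 0 1)) ≤ 1 / (2 * κ)
      * ∫ t in s..y, -(u t)⁻¹ ^ 2 * solDeriv μ a c u t * solDeriv μ a c u t :=
    mul_le_mul_of_nonneg_left hsq (by positivity)
  have h9 : (y - s) * (κ / 2) ≤ κ / 2 := mul_le_of_le_one_left (by positivity) (by linarith)
  have h10 : Real.log (u s) ≤ (κ + μ.real (Icc 0 1) / κ) / 2 + Real.log (u y) := by
    have h11 : (κ + μ.real (Icc 0 1) / κ) / 2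
        = κ / 2 - 1 / (2 * κ) * (-μ.real (Icc 0 1)) := by
      field_simp
      ring
    linarith
  rw [← Real.exp_log (hpos' s ⟨le_rfl, hsy⟩)]
  refine (Real.exp_le_exp.2 h10).trans (le_of_eq ?_)
  rw [Real.exp_add, Real.exp_log (hpos' y ⟨hsy, le_rfl⟩)]

/-- Up to a constant depending only on the mass of `μ`, a positive solution increases on the
way to its maximum. -/
theorem IsVolterraSol.le_exp_mul_of_le (hu : IsVolterraSol μ a c u) (ha : 0 ≤ a)
    (hpos : ∀ x ∈ Ioo (0 : ℝ) 1, 0 < u x) {κ z : ℝ} (hκ : 0 < κ) (hz : z ∈ Ioo (0 : ℝ) 1)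
    (hmax : ∀ t ∈ Icc (0 : ℝ) 1, u t ≤ u z) {t x : ℝ} (ht : 0 ≤ t) (htx : t ≤ x) (hx : 0 < x)
    (hxz : x ≤ z) : u t ≤ Real.exp ((κ + μ.real (Icc 0 1) / κ) / 2) * u x := by
  set C := Real.exp ((κ + μ.real (Icc 0 1) / κ) / 2) with hC
  have hC1 : 1 ≤ C := by
    have : (0 : ℝ) ≤ μ.real (Icc 0 1) := measureReal_nonneg
    exact Real.one_le_exp (by positivity)
  have hx1 : x < 1 := hxz.trans_lt hz.2
  have hux : 0 < u x := hpos x ⟨hx, hx1⟩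
  have hweak : ∀ {w : ℝ}, w ≤ u x → w ≤ C * u x := fun h =>
    h.trans (le_mul_of_one_le_left hux.le hC1)
  obtain ⟨y, hy, hymin⟩ := isCompact_Icc.exists_isMinOn (nonempty_Icc.2 hxz)
    (hu.1.mono (Icc_subset_Icc hx.le hz.2.le))
  have hyx : u y ≤ u x := hymin (a := x) ⟨le_rfl, hxz⟩
  rcases hy.2.eq_or_lt with hyz | hyz
  · refine hweak ((hmax t ⟨ht, htx.trans hx1.le⟩).trans ?_)
    rwa [← hyz]
  have hy0 : 0 < y := hx.trans_le hy.1
  have hy1 : y < 1 := hyz.trans hz.2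
  have hdy := hasDerivWithinAt_Ici_nonneg hyz (hu.hasDerivWithinAt hy0.le hy1)
    fun r hr => hymin (a := r) ⟨hy.1.trans hr.1, hr.2⟩
  obtain ⟨s, hs, hsmax⟩ := isCompact_Icc.exists_isMaxOn (nonempty_Icc.2 hy0.le)
    (hu.1.mono (Icc_subset_Icc_right hy1.le))
  have hts : u t ≤ u s := hsmax (a := t) ⟨ht, htx.trans hy.1⟩
  rcases hs.2.eq_or_lt with hsy | hsy
  · exact hweak (hts.trans (by rwa [hsy]))
  have hs0 : 0 < s := by
    rcases hs.1.eq_or_lt with h | h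
    · have h1 : u y ≤ u s := hsmax (a := y) ⟨hy0.le, le_rfl⟩
      rw [← h, hu.zero] at h1
      exact absurd (hpos y ⟨hy0, hy1⟩) (not_lt.2 h1)
    · exact h
  have hds := hasDerivWithinAt_Ici_nonpos hsy (hu.hasDerivWithinAt hs0.le (hsy.trans hy1))
    fun r hr => hsmax (a := r) ⟨hs.1.trans hr.1, hr.2⟩
  calc u t ≤ u s := hts
    _ ≤ C * u y := hu.le_exp_mul_of_solDeriv_sign ha hpos hκ hs0 hsy.le hy1 hds hdy
    _ ≤ C * u x := mul_le_mul_of_nonneg_left hyx (by positivity)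

end Harnack

/-! ### The quotient of two solutions -/

section Quotient

variable {μ : Measure ℝ} [IsFiniteMeasure μ] {a b c d : ℝ} {u v : ℝ → ℝ}

/-- Although the derivatives jump at the atoms of `μ`, the Wronskian of two solutions is
continuously differentiable: the potential drops out of its derivative. -/
theorem IsVolterraSol.wronskian (hu : IsVolterraSol μ a c u) (hv : IsVolterraSol μ b d v) {x : ℝ}
    (hx : x ∈ Icc (0 : ℝ) 1) :
    solDeriv μ a c u x * v x - u x * solDeriv μ b d v x = (b - a) * ∫ t in Ioc 0 x, u t * v t := by
  have h1 := (hu.integral_mul_solDeriv le_rfl hx.1 hx.2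
    (hv.intervalIntegrable_solDeriv le_rfl hx.1 hx.2)
    (fun t ht => hv.eq_add_integral_solDeriv le_rfl ht.1 (ht.2.trans hx.2))).2
  have h2 := (hv.integral_mul_solDeriv le_rfl hx.1 hx.2
    (hu.intervalIntegrable_solDeriv le_rfl hx.1 hx.2)
    (fun t ht => hu.eq_add_integral_solDeriv le_rfl ht.1 (ht.2.trans hx.2))).2
  have h3 : ∀ ρ : Measure ℝ, ∫ t in Ioc 0 x, v t * u t ∂ρ = ∫ t in Ioc 0 x, u t * v t ∂ρ :=
    fun ρ => by congr 1; ext t; ring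
  have h4 : (∫ t in (0 : ℝ)..x, solDeriv μ b d v t * solDeriv μ a c u t)
      = ∫ t in (0 : ℝ)..x, solDeriv μ a c u t * solDeriv μ b d v t := by congr 1; ext t; ring
  rw [h3, h3, ← h4, h1, hu.zero, hv.zero] at h2
  linarith

theorem IsVolterraSol.integral_mul_eq_zero (hu : IsVolterraSol μ a c u)
    (hv : IsVolterraSol μ b d v) (hab : a ≠ b) (hu1 : u 1 = 0) (hv1 : v 1 = 0) :
    ∫ t in (0 : ℝ)..1, u t * v t = 0 := by
  have h := hu.wronskian hv (x := 1) ⟨zero_le_one, le_rfl⟩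
  rw [hu1, hv1, mul_zero, zero_mul, sub_zero, ← intervalIntegral.integral_of_le zero_le_one] at h
  exact (mul_eq_zero.1 h.symm).resolve_left (sub_ne_zero.2 hab.symm)

/-- On the way to the maximum of the positive solution `u`, the quotient `v/u` is Lipschitz:
its derivative is `-(b - a) u(x)⁻² ∫₀ˣ u² (v/u)`, and the Harnack inequality bounds `u(t)/u(x)`. -/
theorem IsVolterraSol.abs_div_sub_div_le (hu : IsVolterraSol μ a c u)
    (hv : IsVolterraSol μ b d v) (ha : 0 ≤ a) (hab : a ≤ b) (hpos : ∀ x ∈ Ioo (0 : ℝ) 1, 0 < u x)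
    {κ z B : ℝ} (hκ : 0 < κ) (hz : z ∈ Ioo (0 : ℝ) 1) (hmax : ∀ t ∈ Icc (0 : ℝ) 1, u t ≤ u z)
    (hB : 0 ≤ B) (hvB : ∀ t ∈ Ioo (0 : ℝ) 1, |v t| ≤ B * u t) {x y : ℝ} (hx : 0 < x) (hxy : x ≤ y)
    (hy : y ≤ z) :
    |v y / u y - v x / u x| ≤ (b - a) * Real.exp (κ + μ.real (Icc 0 1) / κ) * B * (y - x) := by
  set C := Real.exp ((κ + μ.real (Icc 0 1) / κ) / 2) with hC
  have hC2 : Real.exp (κ + μ.real (Icc 0 1) / κ) = C ^ 2 := by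
    rw [hC, ← Real.exp_nat_mul]
    congr 1
    push_cast
    ring
  have hmem : ∀ t ∈ Icc x y, t ∈ Ioo (0 : ℝ) 1 := fun t ht =>
    ⟨hx.trans_le ht.1, (ht.2.trans hy).trans_lt hz.2⟩
  have hsub : Icc x y ⊆ Icc 0 1 := fun t ht => Ioo_subset_Icc_self (hmem t ht)
  have hne : ∀ t ∈ Icc x y, u t ≠ 0 := fun t ht => (hpos t (hmem t ht)).ne'
  refine norm_image_sub_le_of_norm_deriv_right_le_segment (f := fun t => v t / u t)
    (f' := fun t => (solDeriv μ b d v t * u t - v t * solDeriv μ a c u t) / u t ^ 2)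
    ((hv.1.mono hsub).div (hu.1.mono hsub) hne) ?_ ?_ y ⟨hxy, le_rfl⟩
  · intro t ht
    have ht' := hmem t (Ico_subset_Icc_self ht)
    exact (hv.hasDerivWithinAt ht'.1.le ht'.2).div (hu.hasDerivWithinAt ht'.1.le ht'.2)
      (hne t (Ico_subset_Icc_self ht))
  · intro t ht
    have ht' := hmem t (Ico_subset_Icc_self ht)
    have hut := hpos t ht'
    have hQ := hu.wronskian hv (Ioo_subset_Icc_self ht')
    have hI : ‖∫ r in Ioc 0 t, u r * v r‖ ≤ C ^ 2 * B * u t ^ 2 * volume.real (Ioc 0 t) := by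
      refine norm_setIntegral_le_of_norm_le_const (by simp) fun r hr => ?_
      have hr' : r ∈ Ioo (0 : ℝ) 1 := ⟨hr.1, hr.2.trans_lt ht'.2⟩
      have hur := hpos r hr'
      have h1 := hu.le_exp_mul_of_le ha hpos hκ hz hmax hr.1.le hr.2 ht'.1 (ht.2.le.trans hy)
      rw [Real.norm_eq_abs, abs_mul, abs_of_pos hur]
      calc u r * |v r| ≤ u r * (B * u r) := mul_le_mul_of_nonneg_left (hvB r hr') hur.le
        _ = B * u r ^ 2 := by ring
        _ ≤ B * (C * u t) ^ 2 := by gcongr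
        _ = C ^ 2 * B * u t ^ 2 := by ring
    rw [Real.volume_real_Ioc_of_le ht'.1.le, sub_zero] at hI
    have h2 : solDeriv μ b d v t * u t - v t * solDeriv μ a c u t
        = -((b - a) * ∫ r in Ioc 0 t, u r * v r) := by linarith
    rw [h2, norm_div, norm_neg, norm_mul, Real.norm_of_nonneg (by linarith : 0 ≤ b - a),
      Real.norm_of_nonneg (by positivity : 0 ≤ u t ^ 2), div_le_iff₀ (by positivity), hC2]
    calc (b - a) * ‖∫ r in Ioc 0 t, u r * v r‖
        ≤ (b - a) * (C ^ 2 * B * u t ^ 2 * t) :=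
          mul_le_mul_of_nonneg_left hI (by linarith)
      _ ≤ (b - a) * (C ^ 2 * B * u t ^ 2) := by
          refine mul_le_mul_of_nonneg_left ?_ (by linarith)
          exact mul_le_of_le_one_right (by positivity) ht'.2.le
      _ = (b - a) * C ^ 2 * B * u t ^ 2 := by ring

/-- The quotient `v/u` is bounded up to the left end point, where `v` is at most linear and the
positive solution `u` has a positive slope. -/
theorem IsVolterraSol.exists_abs_le_mul_left (hu : IsVolterraSol μ a c u)
    (hv : IsVolterraSol μ b d v) (hpos : ∀ x ∈ Ioo (0 : ℝ) 1, 0 < u x) :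
    ∃ B, ∀ x ∈ Ioc (0 : ℝ) (1 / 2), |v x| ≤ B * u x := by
  obtain ⟨Bu, hBu, hub⟩ := hu.exists_bound
  obtain ⟨Bv, hBv, hvb⟩ := hv.exists_bound
  have hc : 0 < c := by
    obtain ⟨δ, hδ, -, h⟩ := exists_shoot_pos_near_zero μ a a
    have hx : min δ (1 / 2) ∈ Ioo (0 : ℝ) 1 :=
      ⟨lt_min hδ (by norm_num), (min_le_right _ _).trans_lt (by norm_num)⟩
    have h1 := hpos _ hx
    rw [hu.eq_shoot (Ioo_subset_Icc_self hx)] at h1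
    exact pos_of_mul_pos_left h1 (h a ⟨le_rfl, le_rfl⟩ _ hx.1 (min_le_left _ _)).le
  set K := (|c| + Bu * (μ.real (Icc 0 1) + |a|)) * (μ.real (Icc 0 1) + |a|) with hK
  set L := |d| + Bv * (μ.real (Icc 0 1) + |b|) with hL
  have hK0 : 0 ≤ K := by positivity
  have hL0 : 0 ≤ L := by positivity
  set δ := c / (2 * (K + 1)) with hδ
  have hδ0 : 0 < δ := by positivity
  have hsub : Icc δ (1 / 2) ⊆ Ioo (0 : ℝ) 1 := fun t ht =>
    ⟨hδ0.trans_le ht.1, ht.2.trans_lt (by norm_num)⟩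
  have hsub' := hsub.trans Ioo_subset_Icc_self
  obtain ⟨B, hB⟩ := (isCompact_Icc (a := δ) (b := 1 / 2)).exists_bound_of_continuousOn
    ((hv.1.mono hsub').div (hu.1.mono hsub') fun t ht => (hpos t (hsub ht)).ne')
  refine ⟨max B (2 * L / c), fun x hx => ?_⟩
  have hx' : x ∈ Ioo (0 : ℝ) 1 := ⟨hx.1, hx.2.trans_lt (by norm_num)⟩
  have hux := hpos x hx'
  rcases le_total x δ with h | h
  · refine le_trans ?_ (mul_le_mul_of_nonneg_right (le_max_right _ _) hux.le)
    have h1 := hv.abs_le_mul hBv hvb (Ioo_subset_Icc_self hx')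
    have h2 := (abs_le.1 (hu.abs_sub_le_sq hBu hub (Ioo_subset_Icc_self hx'))).1
    have h3 : x * (2 * (K + 1)) ≤ c := by
      rwa [hδ, le_div_iff₀ (by positivity)] at h
    have h4 : c / 2 * x ≤ u x := by nlinarith [hx.1]
    calc |v x| ≤ L * x := h1
      _ = 2 * L / c * (c / 2 * x) := by field_simp
      _ ≤ 2 * L / c * u x := mul_le_mul_of_nonneg_left h4 (by positivity)
  · refine le_trans ?_ (mul_le_mul_of_nonneg_right (le_max_left _ _) hux.le)
    have h1 := hB x ⟨h, hx.2⟩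
    rwa [Pi.div_apply, norm_div, Real.norm_of_nonneg hux.le, div_le_iff₀ hux] at h1

end Quotient

/-! ### Reflection of the interval -/

section Reflection

variable {μ : Measure ℝ} [IsFiniteMeasure μ] {lam c : ℝ} {u : ℝ → ℝ}

theorem setIntegral_map_one_sub (ρ : Measure ℝ) (f : ℝ → ℝ) :
    ∫ t in Icc (0 : ℝ) 1, f t ∂(ρ.map fun x => 1 - x) = ∫ t in Icc (0 : ℝ) 1, f (1 - t) ∂ρ := by
  have he : MeasurableEmbedding fun x : ℝ => 1 - x :=
    (Homeomorph.subLeft (1 : ℝ)).measurableEmbedding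
  rw [he.setIntegral_map]
  congr 2
  ext t
  simp only [mem_preimage, mem_Icc]
  constructor <;> rintro ⟨h, h'⟩ <;> constructor <;> linarith

theorem measureReal_map_one_sub (ρ : Measure ℝ) :
    (ρ.map fun x => 1 - x).real (Icc 0 1) = ρ.real (Icc 0 1) := by
  have h := setIntegral_map_one_sub ρ fun _ => 1
  simpa using h

/-- The reflection of a solution vanishing at the right end point solves the reflected
equation. -/
theorem IsVolterraSol.reflect (hu : IsVolterraSol μ lam c u) (hu1 : u 1 = 0) :
    ∃ c', IsVolterraSol (μ.map fun x => 1 - x) lam c' fun x => u (1 - x) := by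
  have hmaps : MapsTo (fun x : ℝ => 1 - x) (Icc 0 1) (Icc 0 1) := fun x hx =>
    ⟨by linarith [hx.2], by linarith [hx.1]⟩
  have hi : ∀ (ρ : Measure ℝ) [IsLocallyFiniteMeasure ρ] (g : ℝ → ℝ), Continuous g →
      IntegrableOn (fun t => g t * u t) (Icc 0 1) ρ := fun ρ _ g hg =>
    integrableOn_Icc_of_continuousOn ρ (hg.continuousOn.mul hu.1)
  set A : Measure ℝ → ℝ := fun ρ => ∫ t in Icc (0 : ℝ) 1, u t ∂ρ with hA
  set T : Measure ℝ → ℝ := fun ρ => ∫ t in Icc (0 : ℝ) 1, t * u t ∂ρ with hT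
  -- The kernels `(x - t)₊` and `(t - x)₊` differ by the linear function `x - t`.
  have hsplit : ∀ (ρ : Measure ℝ) [IsLocallyFiniteMeasure ρ] (x : ℝ),
      ∫ t in Icc (0 : ℝ) 1, max (x - t) 0 * u t ∂ρ
        = (∫ t in Icc (0 : ℝ) 1, max (t - x) 0 * u t ∂ρ) + (x * A ρ - T ρ) := fun ρ _ x => by
    have h1 : ∀ t, max (x - t) 0 * u t = max (t - x) 0 * u t + (x * u t - t * u t) := fun t => by
      rcases le_total x t with h | h
      · rw [max_eq_right (by linarith), max_eq_left (by linarith)]; ring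
      · rw [max_eq_left (by linarith), max_eq_right (by linarith)]; ring
    simp_rw [h1]
    have h2 : IntegrableOn (fun t => x * u t) (Icc 0 1) ρ := hi ρ (fun _ => x) (by fun_prop)
    have h3 : IntegrableOn (fun t => t * u t) (Icc 0 1) ρ := hi ρ (fun t => t) (by fun_prop)
    have h4 : IntegrableOn (fun t => x * u t - t * u t) (Icc 0 1) ρ := h2.sub h3
    rw [integral_add (hi ρ (fun t => max (t - x) 0) (by fun_prop)) h4,
      integral_sub h2 h3, integral_const_mul]
  have hone : ∀ (ρ : Measure ℝ) [IsLocallyFiniteMeasure ρ],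
      ∫ t in Icc (0 : ℝ) 1, max (1 - t) 0 * u t ∂ρ = A ρ - T ρ := fun ρ _ => by
    rw [hsplit ρ 1, setIntegral_eq_zero_of_forall_eq_zero, zero_add, one_mul]
    intro t ht
    rw [max_eq_right (by linarith [ht.2]), zero_mul]
  have hrefl : ∀ (ρ : Measure ℝ) (x : ℝ),
      ∫ t in Icc (0 : ℝ) 1, max (x - t) 0 * u (1 - t) ∂(ρ.map fun x => 1 - x)
        = ∫ t in Icc (0 : ℝ) 1, max (t - (1 - x)) 0 * u t ∂ρ := fun ρ x => by
    rw [setIntegral_map_one_sub]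
    congr 1
    ext t
    rw [sub_sub_cancel, show x - (1 - t) = t - (1 - x) by ring]
  have hvol : (volume : Measure ℝ).map (fun x => 1 - x) = volume :=
    (Measure.measurePreserving_sub_left volume (1 : ℝ)).map_eq
  refine ⟨-(T μ - lam * T volume), hu.1.comp (by fun_prop) hmaps, fun x hx => ?_⟩
  have h1 := hu.2 1 ⟨zero_le_one, le_rfl⟩
  rw [hu1, hone, hone] at h1
  have h2 := hu.2 (1 - x) (hmaps hx)
  have h3 := hrefl volume x
  rw [hvol] at h3
  rw [hrefl μ x, h3]
  beta_reduce
  rw [h2, hsplit μ, hsplit volume]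
  linear_combination (-(1 - x)) * h1

end Reflection

/-! ### The gap -/

section Gap

variable {μ : Measure ℝ} [IsFiniteMeasure μ] {a b c d : ℝ} {u v : ℝ → ℝ}

/-- Lower bound for the distance of the lowest eigenvalue to any higher eigenvalue. The quotient
`v/u` changes sign because `u` and `v` are orthogonal, and it is Lipschitz with a constant
proportional to `b - a` and to its own supremum. -/
theorem IsVolterraSol.exp_neg_le_sub (hu : IsVolterraSol μ a c u) (hv : IsVolterraSol μ b d v)
    (ha : 0 ≤ a) (hab : a < b) (hu1 : u 1 = 0) (hv1 : v 1 = 0)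
    (hpos : ∀ x ∈ Ioo (0 : ℝ) 1, 0 < u x) (hvne : ∃ x ∈ Ioo (0 : ℝ) 1, v x ≠ 0) {κ : ℝ}
    (hκ : 0 < κ) : Real.exp (-(κ + μ.real (Icc 0 1) / κ)) ≤ b - a := by
  obtain ⟨c', hu'⟩ := hu.reflect hu1
  obtain ⟨d', hv'⟩ := hv.reflect hv1
  have hfl : ∀ x ∈ Ioo (0 : ℝ) 1, 1 - x ∈ Ioo (0 : ℝ) 1 := fun x hx =>
    ⟨by linarith [hx.2], by linarith [hx.1]⟩
  have hpos' : ∀ x ∈ Ioo (0 : ℝ) 1, 0 < u (1 - x) := fun x hx => hpos _ (hfl x hx)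
  set g : ℝ → ℝ := fun x => v x / u x with hg
  -- The supremum `B` of `|v/u|` is finite and positive.
  obtain ⟨B₁, hB₁⟩ := hu.exists_abs_le_mul_left hv hpos
  obtain ⟨B₂, hB₂⟩ := hu'.exists_abs_le_mul_left hv' hpos'
  have hbdd : BddAbove ((fun x => |g x|) '' Ioo 0 1) := by
    refine ⟨max B₁ B₂, ?_⟩
    rintro _ ⟨x, hx, rfl⟩
    have hux := hpos x hx
    simp only [hg, abs_div, abs_of_pos hux]
    rw [div_le_iff₀ hux]
    rcases le_total x (1 / 2) with h | h
    · exact (hB₁ x ⟨hx.1, h⟩).trans (mul_le_mul_of_nonneg_right (le_max_left _ _) hux.le)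
    · have h1 := hB₂ (1 - x) ⟨by linarith [hx.2], by linarith⟩
      simp only [sub_sub_cancel] at h1
      exact h1.trans (mul_le_mul_of_nonneg_right (le_max_right _ _) hux.le)
  set B := sSup ((fun x => |g x|) '' Ioo 0 1) with hB
  have hgB : ∀ x ∈ Ioo (0 : ℝ) 1, |g x| ≤ B := fun x hx => le_csSup hbdd ⟨x, hx, rfl⟩
  have hB0 : 0 < B := by
    obtain ⟨x, hx, hvx⟩ := hvne
    exact (abs_pos.2 (div_ne_zero hvx (hpos x hx).ne')).trans_le (hgB x hx)
  have hvB : ∀ x ∈ Ioo (0 : ℝ) 1, |v x| ≤ B * u x := fun x hx => by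
    have hux := hpos x hx
    have h1 := hgB x hx
    simp only [hg, abs_div, abs_of_pos hux] at h1
    rwa [div_le_iff₀ hux] at h1
  obtain ⟨z, hz, hzmax⟩ := isCompact_Icc.exists_isMaxOn
    (nonempty_Icc.2 (zero_le_one (α := ℝ))) hu.1
  have hmax : ∀ t ∈ Icc (0 : ℝ) 1, u t ≤ u z := fun t ht => hzmax ht
  have huz : 0 < u z := (hpos (1 / 2) ⟨by norm_num, by norm_num⟩).trans_le
    (hmax _ ⟨by norm_num, by norm_num⟩)
  have hz' : z ∈ Ioo (0 : ℝ) 1 := by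
    refine ⟨lt_of_le_of_ne hz.1 ?_, lt_of_le_of_ne hz.2 ?_⟩ <;> rintro rfl
    · exact huz.ne' hu.zero
    · exact huz.ne' hu1
  set D := (b - a) * Real.exp (κ + μ.real (Icc 0 1) / κ) with hD
  have hD0 : 0 < D := mul_pos (by linarith) (Real.exp_pos _)
  have hleft : ∀ x y, 0 < x → x ≤ y → y ≤ z → |g y - g x| ≤ D * B * (y - x) :=
    fun x y hx hxy hy =>
      hu.abs_div_sub_div_le hv ha hab.le hpos hκ hz' hmax hB0.le hvB hx hxy hy
  have hright : ∀ x y, z ≤ x → x ≤ y → y < 1 → |g y - g x| ≤ D * B * (y - x) :=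
    fun x y hx hxy hy => by
      have h := hu'.abs_div_sub_div_le hv' ha hab.le hpos' hκ (hfl z hz')
        (fun t ht => by
          simp only [sub_sub_cancel]
          exact hmax (1 - t) ⟨by linarith [ht.2], by linarith [ht.1]⟩)
        hB0.le (fun t ht => hvB _ (hfl t ht)) (x := 1 - y) (y := 1 - x) (by linarith)
        (by linarith) (by linarith)
      simp only [sub_sub_cancel, measureReal_map_one_sub] at h
      rw [abs_sub_comm]
      exact h.trans (le_of_eq (by ring))
  have hlip : ∀ x y, 0 < x → x ≤ y → y < 1 → |g y - g x| ≤ D * B * (y - x) :=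
    fun x y hx hxy hy => by
      rcases le_total y z with h | h
      · exact hleft x y hx hxy h
      rcases le_total z x with h' | h'
      · exact hright x y h' hxy hy
      · have h1 := hleft x z hx h' le_rfl
        have h2 := hright z y le_rfl h hy
        have h3 := abs_sub_le (g y) (g z) (g x)
        linarith
  have hosc : ∀ x ∈ Ioo (0 : ℝ) 1, ∀ y ∈ Ioo (0 : ℝ) 1, |g y - g x| ≤ D * B :=
    fun x hx y hy => by
      have hDB : 0 < D * B := mul_pos hD0 hB0
      rcases le_total x y with h | h
      · exact (hlip x y hx.1 h hy.2).trans
          (mul_le_of_le_one_right hDB.le (by linarith [hx.1, hy.2]))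
      · rw [abs_sub_comm]
        exact (hlip y x hy.1 h hx.2).trans
          (mul_le_of_le_one_right hDB.le (by linarith [hy.1, hx.2]))
  have horth := hu.integral_mul_eq_zero hv hab.ne hu1 hv1
  have hcuv : ContinuousOn (fun t => u t * v t) (Icc 0 1) := hu.1.mul hv.1
  have hiuv : IntervalIntegrable (fun t => u t * v t) volume 0 1 :=
    ContinuousOn.intervalIntegrable (by rwa [uIcc_of_le zero_le_one])
  obtain ⟨p, hp, hvp⟩ : ∃ p ∈ Ioo (0 : ℝ) 1, v p ≤ 0 := by
    by_contra! h
    exact (intervalIntegral.intervalIntegral_pos_of_pos_on hiuv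
      (fun x hx => mul_pos (hpos x hx) (h x hx)) zero_lt_one).ne' horth
  obtain ⟨q, hq, hvq⟩ : ∃ q ∈ Ioo (0 : ℝ) 1, 0 ≤ v q := by
    by_contra! h
    have h1 := intervalIntegral.intervalIntegral_pos_of_pos_on hiuv.neg
      (fun x hx => neg_pos.2 (mul_neg_of_pos_of_neg (hpos x hx) (h x hx))) zero_lt_one
    simp only [Pi.neg_apply, intervalIntegral.integral_neg, horth, neg_zero, lt_irrefl] at h1
  have hgp : g p ≤ 0 := div_nonpos_of_nonpos_of_nonneg hvp (hpos p hp).le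
  have hgq : 0 ≤ g q := div_nonneg hvq (hpos q hq).le
  have hBD : B ≤ D * B := by
    refine csSup_le ⟨_, ⟨1 / 2, ⟨by norm_num, by norm_num⟩, rfl⟩⟩ ?_
    rintro _ ⟨x, hx, rfl⟩
    have h1 := abs_le.1 (hosc p hp x hx)
    have h2 := abs_le.1 (hosc q hq x hx)
    exact abs_le.2 ⟨by linarith, by linarith⟩
  have hD1 : 1 ≤ D := le_of_mul_le_mul_right (by linarith) hB0
  rw [Real.exp_neg, inv_le_iff_one_le_mul₀ (Real.exp_pos _)]
  exact hD1

/-- The numerical form of the gap estimate, with `κ = η / 2`. -/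
theorem mul_log_le_exp_neg {η M : ℝ} (hη : 0 < η) (hM : 0 ≤ M)
    (h : Real.pi ^ 2 + 3 * M ≤ η ^ 2) :
    η * Real.log (1 + Real.pi * Real.exp (-2 * η)) ≤ Real.exp (-(η / 2 + M / (η / 2))) := by
  have hpi := Real.pi_gt_three
  have hpi' := Real.pi_lt_d2
  have hηpi : Real.pi ≤ η := by
    refine le_of_sq_le_sq ?_ hη.le
    linarith
  have h1 : Real.log (1 + Real.pi * Real.exp (-2 * η)) ≤ Real.pi * Real.exp (-2 * η) := by
    have := Real.log_le_sub_one_of_pos (x := 1 + Real.pi * Real.exp (-2 * η)) (by positivity)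
    linarith
  have h2 : M / (η / 2) ≤ 2 / 3 * η := by
    rw [div_le_iff₀ (by positivity)]
    nlinarith
  have h3 : Real.pi * η ≤ Real.exp (5 / 6 * η) := by
    -- The tangent of the exponential at `5 / 2` lies above the line of slope `6 π / 5` for `η ≥ π`.
    have e1 : (12 : ℝ) ≤ Real.exp (5 / 2) := by
      have h5 := Real.quadratic_le_exp_of_nonneg (x := 1 / 2) (by norm_num)
      have h6 : Real.exp (5 / 2) = Real.exp 1 ^ 2 * Real.exp (1 / 2) := by
        rw [← Real.exp_nat_mul, ← Real.exp_add]; norm_num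
      have h7 := Real.exp_one_gt_d9
      rw [h6]
      have h8 : (2.718 : ℝ) ^ 2 ≤ Real.exp 1 ^ 2 := pow_le_pow_left₀ (by norm_num) (by linarith) 2
      nlinarith
    have e2 : 1 + (5 / 6 * η - 5 / 2) ≤ Real.exp (5 / 6 * η - 5 / 2) := by
      have := Real.add_one_le_exp (5 / 6 * η - 5 / 2)
      linarith
    have e3 : Real.exp (5 / 6 * η) = Real.exp (5 / 2) * Real.exp (5 / 6 * η - 5 / 2) := by
      rw [← Real.exp_add]; congr 1; ring
    have e4 : 12 * (1 + (5 / 6 * η - 5 / 2)) ≤ Real.exp (5 / 6 * η) := by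
      rw [e3]
      exact mul_le_mul e1 e2 (by linarith) (by positivity)
    nlinarith
  calc η * Real.log (1 + Real.pi * Real.exp (-2 * η))
      ≤ η * (Real.pi * Real.exp (-2 * η)) := mul_le_mul_of_nonneg_left h1 hη.le
    _ = Real.pi * η * Real.exp (-2 * η) := by ring
    _ ≤ Real.exp (5 / 6 * η) * Real.exp (-2 * η) :=
        mul_le_mul_of_nonneg_right h3 (Real.exp_pos _).le
    _ = Real.exp (-(7 / 6 * η)) := by rw [← Real.exp_add]; congr 1; ring
    _ ≤ Real.exp (-(η / 2 + M / (η / 2))) := Real.exp_le_exp.2 (by linarith)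

end Gap

/-! ### Eigenfunctions -/

section Eigenfunctions

/-- The solution with slope `1`, as a complex valued function extended by zero. -/
noncomputable def eigenfun (μ : Measure ℝ) [IsFiniteMeasure μ] (lam : ℝ) : ℝ → ℂ :=
  (Ioo (0 : ℝ) 1).indicator fun x => (shoot μ lam x : ℂ)

variable {μ : Measure ℝ} [IsFiniteMeasure μ] {lam : ℝ}

theorem eigenfun_eq_shoot (h1 : shoot μ lam 1 = 0) {x : ℝ} (hx : x ∈ Icc (0 : ℝ) 1) :
    eigenfun μ lam x = shoot μ lam x := by
  by_cases h : x ∈ Ioo (0 : ℝ) 1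
  · exact indicator_of_mem h _
  · rw [eigenfun, indicator_of_notMem h]
    rcases hx.1.eq_or_lt with h0 | h0
    · rw [← h0, (isVolterraSol_shoot μ lam).zero, Complex.ofReal_zero]
    · have : x = 1 := le_antisymm hx.2 (not_lt.1 fun h' => h ⟨h0, h'⟩)
      rw [this, h1, Complex.ofReal_zero]

theorem exists_shoot_ne_zero (μ : Measure ℝ) [IsFiniteMeasure μ] (lam : ℝ) :
    ∃ x ∈ Ioo (0 : ℝ) 1, shoot μ lam x ≠ 0 := by
  obtain ⟨δ, hδ, -, h⟩ := exists_shoot_pos_near_zero μ lam lam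
  have hx : min δ (1 / 2) ∈ Ioo (0 : ℝ) 1 :=
    ⟨lt_min hδ (by norm_num), (min_le_right _ _).trans_lt (by norm_num)⟩
  exact ⟨_, hx, (h lam ⟨le_rfl, le_rfl⟩ _ hx.1 (min_le_left _ _)).ne'⟩

/-- Uniqueness for complex valued solutions: they are multiples of the real solution with
slope `1`. -/
theorem eq_smul_eigenfun {C : ℂ} {u : ℝ → ℂ} (hc : ContinuousOn u (Icc 0 1))
    (h0 : ∀ x ∉ Ioo (0 : ℝ) 1, u x = 0)
    (hu : ∀ x ∈ Icc (0 : ℝ) 1, u x = C * x + (∫ t in Icc (0 : ℝ) 1, max (x - t) 0 • u t ∂μ)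
      - lam * ∫ t in Icc (0 : ℝ) 1, max (x - t) 0 • u t) :
    u = C • eigenfun μ lam ∧ (C ≠ 0 → shoot μ lam 1 = 0) := by
  have hi : ∀ (ρ : Measure ℝ) [IsLocallyFiniteMeasure ρ] (x : ℝ),
      Integrable (fun t => max (x - t) 0 • u t) (ρ.restrict (Icc 0 1)) := fun ρ _ x => by
    have hk : ContinuousOn (fun t : ℝ => max (x - t) 0) (Icc 0 1) := by fun_prop
    exact (hk.smul hc).integrableOn_compact isCompact_Icc
  have hre : IsVolterraSol μ lam C.re fun x => (u x).re := by
    refine ⟨Complex.continuous_re.comp_continuousOn hc, fun x hx => ?_⟩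
    have h1 : ∀ (ρ : Measure ℝ) [IsLocallyFiniteMeasure ρ],
        (∫ t in Icc (0 : ℝ) 1, max (x - t) 0 • u t ∂ρ).re
          = ∫ t in Icc (0 : ℝ) 1, max (x - t) 0 * (u t).re ∂ρ := fun ρ _ => by
      rw [← Complex.reCLM_apply, ← Complex.reCLM.integral_comp_comm (hi ρ x)]
      simp
    beta_reduce
    rw [← h1, ← h1, hu x hx]
    simp
  have him : IsVolterraSol μ lam C.im fun x => (u x).im := by
    refine ⟨Complex.continuous_im.comp_continuousOn hc, fun x hx => ?_⟩
    have h1 : ∀ (ρ : Measure ℝ) [IsLocallyFiniteMeasure ρ],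
        (∫ t in Icc (0 : ℝ) 1, max (x - t) 0 • u t ∂ρ).im
          = ∫ t in Icc (0 : ℝ) 1, max (x - t) 0 * (u t).im ∂ρ := fun ρ _ => by
      rw [← Complex.imCLM_apply, ← Complex.imCLM.integral_comp_comm (hi ρ x)]
      simp
    beta_reduce
    rw [← h1, ← h1, hu x hx]
    simp
  have hmul : ∀ x ∈ Icc (0 : ℝ) 1, u x = C * shoot μ lam x := fun x hx => by
    apply Complex.ext
    · simpa using hre.eq_shoot hx
    · simpa using him.eq_shoot hx
  constructor
  · ext x
    by_cases h : x ∈ Ioo (0 : ℝ) 1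
    · rw [Pi.smul_apply, eigenfun, indicator_of_mem h, smul_eq_mul,
        hmul x (Ioo_subset_Icc_self h)]
    · rw [Pi.smul_apply, eigenfun, indicator_of_notMem h, smul_zero, h0 x h]
  · intro hC
    have h1 := hmul 1 ⟨zero_le_one, le_rfl⟩
    rw [h0 1 (by simp)] at h1
    exact_mod_cast (mul_eq_zero.1 h1.symm).resolve_left hC

theorem IsH10.intervalIntegrable {u u' : ℝ → ℂ} (h : IsH10 u u') {y x : ℝ}
    (hy : y ∈ Icc (0 : ℝ) 1) (hx : x ∈ Icc (0 : ℝ) 1) : IntervalIntegrable u' volume y x := by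
  have : IsFiniteMeasure unitVolume := by unfold unitVolume; infer_instance
  have h1 : IntegrableOn u' (Icc 0 1) volume := h.1.integrable one_le_two
  rw [intervalIntegrable_iff']
  exact h1.mono_set (uIcc_subset_Icc hy hx)

theorem IsH10.continuousOn {u u' : ℝ → ℂ} (h : IsH10 u u') : ContinuousOn u (Icc 0 1) := by
  have : IsFiniteMeasure unitVolume := by unfold unitVolume; infer_instance
  have h1 : IntegrableOn u' (Icc 0 1) volume := h.1.integrable one_le_two
  have h2 := intervalIntegral.continuousOn_primitive_interval (a := 0) (b := 1) (f := u')
    (μ := volume) (by rwa [uIcc_of_le zero_le_one])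
  rw [uIcc_of_le zero_le_one] at h2
  exact h2.congr h.2.1

theorem abs_solDeriv_le {c : ℝ} {u : ℝ → ℝ} (hu : IsVolterraSol μ lam c u) :
    ∃ B, ∀ x ∈ Icc (0 : ℝ) 1, |solDeriv μ lam c u x| ≤ B := by
  obtain ⟨B, hB, hub⟩ := hu.exists_bound
  refine ⟨|c| + B * μ.real (Icc 0 1) + |lam| * (B * 1), fun x hx => ?_⟩
  have hss : Ioc 0 x ⊆ Icc 0 1 := fun s hs => ⟨hs.1.le, hs.2.trans hx.2⟩
  have hb : ∀ (ρ : Measure ℝ) [IsLocallyFiniteMeasure ρ],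
      |∫ s in Ioc 0 x, u s ∂ρ| ≤ B * ρ.real (Icc 0 1) := fun ρ _ => by
    have hfin : ρ (Icc 0 1) < ⊤ := isCompact_Icc.measure_lt_top
    have h2 : ‖∫ s in Ioc 0 x, u s ∂ρ‖ ≤ B * ρ.real (Ioc 0 x) :=
      norm_setIntegral_le_of_norm_le_const ((measure_mono hss).trans_lt hfin)
        fun s hs => hub s (hss hs)
    exact h2.trans (mul_le_mul_of_nonneg_left (measureReal_mono hss hfin.ne) hB)
  have h3 := hb μ
  have h4 := hb volume
  have hvol : (volume : Measure ℝ).real (Icc 0 1) = 1 := by simp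
  rw [hvol] at h4
  refine (abs_sub _ _).trans (add_le_add ((abs_add_le _ _).trans (add_le_add le_rfl h3)) ?_)
  rw [abs_mul]
  exact mul_le_mul_of_nonneg_left h4 (abs_nonneg _)

theorem isH10_eigenfun (h1 : shoot μ lam 1 = 0) :
    IsH10 (eigenfun μ lam) fun x => (solDeriv μ lam 1 (shoot μ lam) x : ℂ) := by
  have hu := isVolterraSol_shoot μ lam
  refine ⟨?_, fun x hx => ?_, fun x hx => indicator_of_notMem hx _⟩
  · obtain ⟨B, hB⟩ := abs_solDeriv_le hu
    have : IsFiniteMeasure unitVolume := by unfold unitVolume; infer_instance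
    have hi : IntegrableOn (solDeriv μ lam 1 (shoot μ lam)) (Icc 0 1) volume :=
      (intervalIntegrable_iff_integrableOn_Icc_of_le zero_le_one).1
        (hu.intervalIntegrable_solDeriv le_rfl zero_le_one le_rfl)
    refine MemLp.of_bound hi.ofReal.1 B ?_
    refine (ae_restrict_mem measurableSet_Icc).mono fun x hx => ?_
    simpa using hB x hx
  · rw [eigenfun_eq_shoot h1 hx, hu.eq_integral_solDeriv hx, intervalIntegral.integral_ofReal]

end Eigenfunctions

/-! ### The two graphs -/

section Graphs

variable {μ : Measure ℝ} [IsFiniteMeasure μ] {lam : ℝ}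

theorem integral_mul_eq_setIntegral {f g : ℝ → ℂ} (ρ : Measure ℝ) {s : Set ℝ}
    (hs : Ioo 0 1 ⊆ s) (hg : ∀ x ∉ Ioo (0 : ℝ) 1, g x = 0) :
    ∫ x, f x * g x ∂ρ = ∫ x in s, f x * g x ∂ρ :=
  (setIntegral_eq_integral_of_forall_compl_eq_zero fun x hx => by
    rw [hg x fun h => hx (hs h), mul_zero]).symm

/-- Integration by parts of the derivative of the solution against a test function. -/
theorem formGraph_eigenfun (h1 : shoot μ lam 1 = 0) :
    FormGraph μ (eigenfun μ lam) fun x => (lam : ℂ) * eigenfun μ lam x := by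
  have hu := isVolterraSol_shoot μ lam
  have hH := isH10_eigenfun h1
  have : IsFiniteMeasure unitVolume := by unfold unitVolume; infer_instance
  refine ⟨_, hH, ?_, fun v v' hv => ?_⟩
  · obtain ⟨B, hB⟩ := isCompact_Icc.exists_bound_of_continuousOn hH.continuousOn
    refine (MemLp.of_bound (hH.continuousOn.aestronglyMeasurable measurableSet_Icc) B ?_).const_mul _
    exact (ae_restrict_mem measurableSet_Icc).mono hB
  · have h0 : (0 : ℝ) ∈ Icc (0 : ℝ) 1 := ⟨le_rfl, zero_le_one⟩
    have h1' : (1 : ℝ) ∈ Icc (0 : ℝ) 1 := ⟨zero_le_one, le_rfl⟩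
    have hvi := hv.intervalIntegrable h0 h1'
    have hv0 : v 0 = 0 := hv.2.2 0 (by simp)
    have hv1 : v 1 = 0 := hv.2.2 1 (by simp)
    have hconj : ∀ t ∈ Icc (0 : ℝ) 1, conj (v t) = conj (v 0) + ∫ s in (0 : ℝ)..t, conj (v' s) :=
      fun t ht => by
        rw [hv0, map_zero, zero_add, hv.2.1 t ht, intervalIntegral.integral_of_le ht.1,
          intervalIntegral.integral_of_le ht.1, ← integral_conj]
    have hvi' : IntervalIntegrable (fun t => conj (v' t)) volume 0 1 := by
      rw [intervalIntegrable_iff] at hvi ⊢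
      exact (Complex.conjCLE.toContinuousLinearMap.integrable_comp hvi :)
    have h2 := (hu.integral_mul_ofReal_solDeriv le_rfl zero_le_one le_rfl hvi' hconj).2
    simp only [RCLike.ofReal_eq_complex_ofReal] at h2
    have hset : ∀ ρ : Measure ℝ, ∫ t in Ioc (0 : ℝ) 1, conj (v t) * eigenfun μ lam t ∂ρ
        = ∫ t in Ioc (0 : ℝ) 1, (shoot μ lam t : ℂ) * conj (v t) ∂ρ := fun ρ =>
      setIntegral_congr_fun measurableSet_Ioc fun t ht => by
        simp only [eigenfun_eq_shoot h1 (Ioc_subset_Icc_self ht), mul_comm]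
    have e1 : ∫ x, conj (v' x) * (solDeriv μ lam 1 (shoot μ lam) x : ℂ) ∂unitVolume
        = ∫ t in (0 : ℝ)..1, conj (v' t) * (solDeriv μ lam 1 (shoot μ lam) t : ℂ) := by
      rw [unitVolume, integral_Icc_eq_integral_Ioc, intervalIntegral.integral_of_le zero_le_one]
    have e2 : ∫ x, conj (v x) * (lam * eigenfun μ lam x) ∂unitVolume
        = lam * ∫ t in Ioc (0 : ℝ) 1, (shoot μ lam t : ℂ) * conj (v t) := by
      rw [← hset, unitVolume, integral_Icc_eq_integral_Ioc, ← integral_const_mul]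
      congr 1; ext t; ring
    rw [e1, e2, h2, integral_mul_eq_setIntegral μ Ioo_subset_Ioc_self hH.2.2, hset, hv0, hv1]
    simp

/-- The Green function of `-∂²`, as a function in `H¹₀(0,1)`. -/
theorem isH10_green {x : ℝ} (hx : x ∈ Icc (0 : ℝ) 1) :
    IsH10 ((Ioo (0 : ℝ) 1).indicator fun t => ((x * (1 - t) - max (x - t) 0 : ℝ) : ℂ))
      fun t => (-x : ℂ) + (Iic x).indicator (fun _ => 1) t := by
  have hm : Measurable fun t : ℝ => (-x : ℂ) + (Iic x).indicator (fun _ => 1) t :=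
    measurable_const.add (measurable_const.indicator measurableSet_Iic)
  have : IsFiniteMeasure unitVolume := by unfold unitVolume; infer_instance
  refine ⟨MemLp.of_bound hm.aestronglyMeasurable (‖(-x : ℂ)‖ + 1) (Eventually.of_forall fun t => ?_),
    fun s hs => ?_, fun s hs => indicator_of_notMem hs _⟩
  · refine (norm_add_le _ _).trans (add_le_add le_rfl ?_)
    exact (norm_indicator_le_norm_self _ _).trans (by simp)
  · have hi : IntervalIntegrable ((Iic x).indicator fun _ => (1 : ℂ)) volume 0 s := by
      rw [intervalIntegrable_iff]
      exact (integrableOn_const (by simp)).indicator measurableSet_Iic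
    rw [intervalIntegral.integral_add intervalIntegrable_const hi,
      intervalIntegral.integral_const, intervalIntegral.integral_of_le hs.1,
      setIntegral_indicator measurableSet_Iic, Ioc_inter_Iic, setIntegral_const,
      Real.volume_real_Ioc_of_le (le_min hs.1 hx.1)]
    have hval : ((x * (1 - s) - max (x - s) 0 : ℝ) : ℂ)
        = (s - 0 : ℝ) • (-x : ℂ) + (min s x - 0 : ℝ) • (1 : ℂ) := by
      simp only [sub_zero, Complex.real_smul, mul_one]
      norm_cast
      rcases le_total s x with h | h
      · rw [min_eq_left h, max_eq_left (by linarith)]; ring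
      · rw [min_eq_right h, max_eq_right (by linarith)]; ring
    rw [← hval]
    by_cases h : s ∈ Ioo (0 : ℝ) 1
    · exact indicator_of_mem h _
    · rw [indicator_of_notMem h]
      rcases hs.1.eq_or_lt with h0 | h0
      · rw [← h0, max_eq_left (by linarith [hx.1])]; simp
      · have : s = 1 := le_antisymm hs.2 (not_lt.1 fun h' => h ⟨h0, h'⟩)
        rw [this, max_eq_right (by linarith [hx.2])]; simp

/-- Testing the weak equation with the Green function `x (1 - t) - (x - t)₊` of `-∂²` evaluates `u`
at the point `x` and gives the Volterra equation. -/
theorem FormGraph.eq_smul_eigenfun {u : ℝ → ℂ}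
    (h : FormGraph μ u fun x => (lam : ℂ) * u x) :
    ∃ C : ℂ, u = C • eigenfun μ lam ∧ (C ≠ 0 → shoot μ lam 1 = 0) := by
  obtain ⟨u', hu, -, hv⟩ := h
  have hc := hu.continuousOn
  have hi : ∀ (ρ : Measure ℝ) [IsLocallyFiniteMeasure ρ] (g : ℝ → ℝ), Continuous g →
      Integrable (fun t => g t • u t) (ρ.restrict (Icc 0 1)) := fun ρ _ g hg =>
    ContinuousOn.integrableOn_compact isCompact_Icc (hg.continuousOn.smul hc)
  set A : Measure ℝ → ℂ := fun ρ => ∫ t in Icc (0 : ℝ) 1, (1 - t) • u t ∂ρ with hA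
  refine ⟨lam * A volume - A μ, EnergyGap.eq_smul_eigenfun hc hu.2.2 fun x hx => ?_⟩
  have hG := hv _ _ (isH10_green hx)
  have hgreen : ∀ (ρ : Measure ℝ) [IsLocallyFiniteMeasure ρ],
      ∫ t in Icc (0 : ℝ) 1,
        conj ((Ioo (0 : ℝ) 1).indicator
          (fun t => ((x * (1 - t) - max (x - t) 0 : ℝ) : ℂ)) t) * u t ∂ρ
        = x * A ρ - ∫ t in Icc (0 : ℝ) 1, max (x - t) 0 • u t ∂ρ := fun ρ _ => by
    rw [hA, ← integral_const_mul, ← integral_sub ((hi ρ _ (by fun_prop)).const_mul _)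
      (hi ρ _ (by fun_prop))]
    congr 1
    ext t
    by_cases ht : t ∈ Ioo (0 : ℝ) 1
    · rw [indicator_of_mem ht, Complex.conj_ofReal]
      simp only [Complex.real_smul]
      push_cast
      ring
    · simp [hu.2.2 t ht]
  have h0 : (0 : ℝ) ∈ Icc (0 : ℝ) 1 := ⟨le_rfl, zero_le_one⟩
  have h1' : (1 : ℝ) ∈ Icc (0 : ℝ) 1 := ⟨zero_le_one, le_rfl⟩
  have hui : IntegrableOn u' (Ioc 0 1) volume :=
    (intervalIntegrable_iff_integrableOn_Ioc_of_le zero_le_one).1 (hu.intervalIntegrable h0 h1')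
  have e1 : ∫ t, conj ((-x : ℂ) + (Iic x).indicator (fun _ => 1) t) * u' t ∂unitVolume = u x := by
    have hsplit : ∀ t, conj ((-x : ℂ) + (Iic x).indicator (fun _ => 1) t) * u' t
        = -x * u' t + (Iic x).indicator u' t := fun t => by
      by_cases ht : t ∈ Iic x
      · rw [indicator_of_mem ht, indicator_of_mem ht]
        simp [add_mul]
      · rw [indicator_of_notMem ht, indicator_of_notMem ht]
        simp
    simp_rw [hsplit]
    rw [unitVolume, integral_Icc_eq_integral_Ioc,
      integral_add (hui.const_mul _) (hui.indicator measurableSet_Iic), integral_const_mul,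
      setIntegral_indicator measurableSet_Iic, Ioc_inter_Iic, min_eq_right hx.2,
      ← intervalIntegral.integral_of_le zero_le_one, ← intervalIntegral.integral_of_le hx.1,
      ← hu.2.1 1 h1', ← hu.2.1 x hx, hu.2.2 1 (by simp)]
    simp
  have e2 : ∫ t, conj ((Ioo (0 : ℝ) 1).indicator
      (fun t => ((x * (1 - t) - max (x - t) 0 : ℝ) : ℂ)) t) * (lam * u t) ∂unitVolume
      = lam * (x * A volume - ∫ t in Icc (0 : ℝ) 1, max (x - t) 0 • u t) := by
    rw [← hgreen, ← integral_const_mul, unitVolume]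
    congr 1; ext t; ring
  rw [e1, e2, integral_mul_eq_setIntegral μ Ioo_subset_Icc_self hu.2.2, hgreen] at hG
  linear_combination hG

/-- The measure with density `W` on the unit interval. -/
noncomputable def densityMeasure (W : ℝ → ℝ) : Measure ℝ :=
  unitVolume.withDensity fun x => ENNReal.ofReal (W x)

theorem setIntegral_densityMeasure {E : Type*} [NormedAddCommGroup E] [NormedSpace ℝ E]
    {W : ℝ → ℝ} (hW : ContinuousOn W (Icc 0 1)) (hW0 : ∀ x ∈ Icc (0 : ℝ) 1, 0 ≤ W x) (f : ℝ → E)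
    {s : Set ℝ} (hs : MeasurableSet s) (hs1 : s ⊆ Icc 0 1) :
    ∫ t in s, f t ∂(densityMeasure W) = ∫ t in s, W t • f t := by
  have hres : unitVolume.restrict s = volume.restrict s := by
    rw [unitVolume, Measure.restrict_restrict hs, inter_eq_left.2 hs1]
  rw [densityMeasure, setIntegral_withDensity_eq_setIntegral_toReal_smul₀ _ _ _ hs, hres]
  · refine setIntegral_congr_fun hs fun t ht => ?_
    simp only [ENNReal.toReal_ofReal (hW0 t (hs1 ht))]
  · rw [hres]
    exact ((hW.mono hs1).aemeasurable hs).ennreal_ofReal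
  · exact Eventually.of_forall fun t => ENNReal.ofReal_lt_top

theorem isFiniteMeasure_densityMeasure {W : ℝ → ℝ} (hW : ContinuousOn W (Icc 0 1)) :
    IsFiniteMeasure (densityMeasure W) :=
  isFiniteMeasure_withDensity_ofReal
    (hW.integrableOn_compact (μ := volume) isCompact_Icc).hasFiniteIntegral

theorem schrodingerGraph_eigenfun {W : ℝ → ℝ} (hW : ContinuousOn W (Icc 0 1))
    (hW0 : ∀ x ∈ Icc (0 : ℝ) 1, 0 ≤ W x) [IsFiniteMeasure (densityMeasure W)]
    (h1 : shoot (densityMeasure W) lam 1 = 0) :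
    SchrodingerGraph W (eigenfun (densityMeasure W) lam)
      fun x => (lam : ℂ) * eigenfun (densityMeasure W) lam x := by
  have hu := isVolterraSol_shoot (densityMeasure W) lam
  have hH := isH10_eigenfun h1
  have : IsFiniteMeasure unitVolume := by unfold unitVolume; infer_instance
  have hcont : ContinuousOn (fun x => ((W x : ℂ) - lam) * eigenfun (densityMeasure W) lam x) (Icc 0 1) :=
    ((Complex.continuous_ofReal.comp_continuousOn hW).sub continuousOn_const).mul hH.continuousOn
  refine ⟨_, fun x => ((W x : ℂ) - lam) * eigenfun (densityMeasure W) lam x, hH, ?_, fun x hx => ?_, ?_⟩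
  · obtain ⟨B, hB⟩ := isCompact_Icc.exists_bound_of_continuousOn hcont
    refine MemLp.of_bound (hcont.aestronglyMeasurable measurableSet_Icc) B ?_
    exact (ae_restrict_mem measurableSet_Icc).mono hB
  · have hss : Ioc 0 x ⊆ Icc (0 : ℝ) 1 := fun t ht => ⟨ht.1.le, ht.2.trans hx.2⟩
    have hi1 : IntegrableOn (fun t => W t • shoot (densityMeasure W) lam t) (Ioc 0 x) :=
      ((hW.smul hu.1).integrableOn_compact isCompact_Icc).mono_set hss
    have hi2 := hu.integrableOn volume (y := 0) (x := x) le_rfl hx.2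
    have h2 : ∫ t in Ioc 0 x, ((W t : ℂ) - lam) * eigenfun (densityMeasure W) lam t
        = ((∫ t in Ioc 0 x, (W t • shoot (densityMeasure W) lam t - lam * shoot (densityMeasure W) lam t) : ℝ) : ℂ) := by
      rw [← integral_complex_ofReal]
      refine setIntegral_congr_fun measurableSet_Ioc fun t ht => ?_
      simp only [eigenfun_eq_shoot h1 (hss ht), smul_eq_mul]
      push_cast
      ring
    rw [intervalIntegral.integral_of_le hx.1, h2, integral_sub hi1 (hi2.const_mul _),
      integral_const_mul, ← setIntegral_densityMeasure hW hW0 _ measurableSet_Ioc hss]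
    simp only [solDeriv, Ioc_self, Measure.restrict_empty, integral_zero_measure]
    push_cast
    ring
  · refine Eventually.of_forall fun x => ?_
    ring

/-- Integrating `u'' = (W - lam) u` twice gives the Volterra equation for the measure with
density `W`. -/
theorem SchrodingerGraph.eq_smul_eigenfun {W : ℝ → ℝ} (hW : ContinuousOn W (Icc 0 1))
    (hW0 : ∀ x ∈ Icc (0 : ℝ) 1, 0 ≤ W x) [IsFiniteMeasure (densityMeasure W)] {u : ℝ → ℂ}
    (h : SchrodingerGraph W u fun x => (lam : ℂ) * u x) :
    ∃ C : ℂ, u = C • eigenfun (densityMeasure W) lam ∧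
      (C ≠ 0 → shoot (densityMeasure W) lam 1 = 0) := by
  obtain ⟨u', u'', hu, hu2, hu', heq⟩ := h
  have hc := hu.continuousOn
  have : IsFiniteMeasure unitVolume := by unfold unitVolume; infer_instance
  have hi2 : IntegrableOn u'' (Icc 0 1) volume := hu2.integrable one_le_two
  refine ⟨u' 0, EnergyGap.eq_smul_eigenfun hc hu.2.2 fun x hx => ?_⟩
  have hss : Ioc 0 x ⊆ Icc (0 : ℝ) 1 := fun t ht => ⟨ht.1.le, ht.2.trans hx.2⟩
  have hu0 : u 0 = 0 := hu.2.2 0 (by simp)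
  have h1 := (integral_mul_eq_sub_of_Ioc (𝕜 := ℂ) volume hx.1 (f := fun _ => 1)
    (F := fun t => (t : ℂ) - x) (h := u'') (k := u') intervalIntegrable_const
    (hi2.mono_set hss) (fun t _ => by simp; ring)
    (fun t ht => by
      rw [hu' t ⟨ht.1, ht.2.trans hx.2⟩, intervalIntegral.integral_of_le ht.1])).2
  simp only [one_mul] at h1
  rw [integral_kernel_eq_integral_Ioc _ hu0 hx, integral_kernel_eq_integral_Ioc _ hu0 hx,
    setIntegral_densityMeasure hW hW0 _ measurableSet_Ioc hss, hu.2.1 x hx, h1]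
  have hk : ContinuousOn (fun t : ℝ => x - t) (Icc 0 1) := by fun_prop
  have hiA : IntegrableOn (fun t => W t • (x - t) • u t) (Ioc 0 x) :=
    ((hW.smul (hk.smul hc)).integrableOn_compact isCompact_Icc).mono_set hss
  have hiB : IntegrableOn (fun t => (x - t) • u t) (Ioc 0 x) :=
    ((hk.smul hc).integrableOn_compact isCompact_Icc).mono_set hss
  have h2 : ∫ t in Ioc 0 x, u'' t * ((t : ℂ) - x)
      = ∫ t in Ioc 0 x, (lam * ((x - t) • u t) - W t • (x - t) • u t) := by
    refine integral_congr_ae ?_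
    have heq' : ∀ᵐ t ∂volume.restrict (Ioc 0 x), -u'' t + (W t : ℂ) * u t = lam * u t :=
      ae_mono (Measure.restrict_mono hss le_rfl) heq
    filter_upwards [heq'] with t ht
    simp only [Complex.real_smul]
    push_cast
    linear_combination (x - t : ℂ) * ht
  rw [h2, integral_sub (hiB.const_mul _) hiA, integral_const_mul]
  simp
  ring

end Graphs

/-! ### The two lowest eigenvalues -/

section Spectrum

variable {μ : Measure ℝ} [IsFiniteMeasure μ]

/-- Eigenfunctions to different eigenvalues are linearly independent, being orthogonal. -/
theorem eq_zero_of_smul_eigenfun_add {a b : ℝ} (hab : a ≠ b) (ha : shoot μ a 1 = 0)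
    (hb : shoot μ b 1 = 0) {α β : ℝ}
    (h : ∀ x ∈ Ioo (0 : ℝ) 1, α * shoot μ a x + β * shoot μ b x = 0) : α = 0 := by
  have hu := isVolterraSol_shoot μ a
  have hv := isVolterraSol_shoot μ b
  have hcu := continuous_shoot μ a
  have hcv := continuous_shoot μ b
  have horth := hu.integral_mul_eq_zero hv hab ha hb
  have h1 : ∫ t in (0 : ℝ)..1, (α * (shoot μ a t * shoot μ a t)
      + β * (shoot μ a t * shoot μ b t)) = ∫ _ in (0 : ℝ)..1, (0 : ℝ) := by
    refine intervalIntegral.integral_congr_uIoo fun t ht => ?_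
    rw [uIoo_of_le zero_le_one] at ht
    linear_combination shoot μ a t * h t ht
  rw [intervalIntegral.integral_add (Continuous.intervalIntegrable (by fun_prop) _ _)
    (Continuous.intervalIntegrable (by fun_prop) _ _), intervalIntegral.integral_const_mul,
    intervalIntegral.integral_const_mul, horth, mul_zero, add_zero,
    intervalIntegral.integral_zero] at h1
  refine (mul_eq_zero.1 h1).resolve_right (ne_of_gt ?_)
  obtain ⟨x, hx, hx0⟩ := exists_shoot_ne_zero μ a
  exact intervalIntegral.integral_pos zero_lt_one (hcu.mul hcu).continuousOn
    (fun t _ => mul_self_nonneg _) ⟨x, Ioo_subset_Icc_self hx, mul_self_pos.2 hx0⟩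

theorem linearIndependent_eigenfun {a b : ℝ} (hab : a ≠ b) (ha : shoot μ a 1 = 0)
    (hb : shoot μ b 1 = 0) : LinearIndependent ℂ ![eigenfun μ a, eigenfun μ b] := by
  refine LinearIndependent.pair_iff.2 fun s t hst => ?_
  have h : ∀ x ∈ Ioo (0 : ℝ) 1, s * shoot μ a x + t * shoot μ b x = 0 := fun x hx => by
    have h1 := congrFun hst x
    simpa [eigenfun, indicator_of_mem hx] using h1
  have hre : ∀ x ∈ Ioo (0 : ℝ) 1, s.re * shoot μ a x + t.re * shoot μ b x = 0 := fun x hx => by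
    simpa using congrArg Complex.re (h x hx)
  have him : ∀ x ∈ Ioo (0 : ℝ) 1, s.im * shoot μ a x + t.im * shoot μ b x = 0 := fun x hx => by
    simpa using congrArg Complex.im (h x hx)
  refine ⟨Complex.ext ?_ ?_, Complex.ext ?_ ?_⟩
  · exact eq_zero_of_smul_eigenfun_add hab ha hb hre
  · exact eq_zero_of_smul_eigenfun_add hab ha hb him
  · exact eq_zero_of_smul_eigenfun_add hab.symm hb ha (β := s.re) fun x hx => by linarith [hre x hx]
  · exact eq_zero_of_smul_eigenfun_add hab.symm hb ha (β := s.im) fun x hx => by linarith [him x hx]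

/-- If the eigenfunctions of a graph are the multiples of the solutions of the initial value
problem which vanish at the right end point, then its two lowest eigenvalues exist and are
separated by the gap estimate. -/
theorem exists_eigenvalues_of_graph {G : (ℝ → ℂ) → (ℝ → ℂ) → Prop}
    (hG : ∀ lam : ℝ, shoot μ lam 1 = 0 → G (eigenfun μ lam) fun x => (lam : ℂ) * eigenfun μ lam x)
    (hG' : ∀ (lam : ℝ) (u : ℝ → ℂ), G u (fun x => (lam : ℂ) * u x) →
      ∃ C : ℂ, u = C • eigenfun μ lam ∧ (C ≠ 0 → shoot μ lam 1 = 0)) :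
    ∃ e₀ e₁ : ℝ, IsNthEigenvalue G 0 e₀ ∧ IsNthEigenvalue G 1 e₁ ∧ 0 < e₀ ∧ e₀ < e₁ ∧
      ∀ κ : ℝ, 0 < κ → Real.exp (-(κ + μ.real (Icc 0 1) / κ)) ≤ e₁ - e₀ := by
  obtain ⟨e₀, he0, hD0, hpos, hlow⟩ := exists_ground_state μ
  have hgap : ∀ lam, e₀ < lam → shoot μ lam 1 = 0 → ∀ κ : ℝ, 0 < κ →
      Real.exp (-(κ + μ.real (Icc 0 1) / κ)) ≤ lam - e₀ := fun lam hlam h0 κ hκ =>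
    (isVolterraSol_shoot μ e₀).exp_neg_le_sub (isVolterraSol_shoot μ lam) he0.le hlam hD0 h0 hpos
      (exists_shoot_ne_zero μ lam) hκ
  set g := Real.exp (-(1 + μ.real (Icc 0 1) / 1)) with hg
  have hg0 : 0 < g := Real.exp_pos _
  -- The gap makes the set of the higher zeros closed, so that it has a least element.
  have hclosed : IsClosed {lam : ℝ | e₀ + g ≤ lam ∧ shoot μ lam 1 = 0} :=
    (isClosed_le continuous_const continuous_id).inter
      (isClosed_eq (continuous_shoot_left μ 1) continuous_const)
  obtain ⟨R, hR, hR0⟩ := exists_shoot_one_eq_zero_gt μ (e₀ + g)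
  have hleast := hclosed.isLeast_csInf ⟨R, hR.le, hR0⟩ ⟨e₀ + g, fun _ h => h.1⟩
  set e₁ := sInf {lam : ℝ | e₀ + g ≤ lam ∧ shoot μ lam 1 = 0} with he₁
  obtain ⟨⟨hge, hD1⟩, hmin⟩ := hleast
  have hlt : e₀ < e₁ := by linarith
  have hne : ∀ lam : ℝ, eigenfun μ lam ≠ 0 := fun lam h => by
    obtain ⟨x, hx, hx0⟩ := exists_shoot_ne_zero μ lam
    have h1 := congrFun h x
    rw [eigenfun, indicator_of_mem hx] at h1
    exact hx0 (Complex.ofReal_eq_zero.1 h1)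
  have hzero : ∀ (lam : ℝ) (u : ℝ → ℂ), u ≠ 0 → G u (fun x => (lam : ℂ) * u x) →
      ∃ C : ℂ, C ≠ 0 ∧ u = C • eigenfun μ lam ∧ shoot μ lam 1 = 0 := fun lam u hu h => by
    obtain ⟨C, hC, hC0⟩ := hG' lam u h
    have hCne : C ≠ 0 := fun h0 => hu (by rw [hC, h0, zero_smul])
    exact ⟨C, hCne, hC, hC0 hCne⟩
  refine ⟨e₀, e₁, ⟨?_, ?_⟩, ⟨?_, ?_⟩, he0, hlt, hgap e₁ hlt hD1⟩
  · exact ⟨fun _ => eigenfun μ e₀, (linearIndependent_unique_iff (ι := Fin 1)).2 (hne e₀),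
      fun _ => ⟨e₀, le_rfl, hG e₀ hD0⟩⟩
  · rintro E ⟨u, hli, hu⟩
    obtain ⟨lam, hlam, h⟩ := hu 0
    obtain ⟨-, -, -, h0⟩ := hzero lam (u 0) (hli.ne_zero 0) h
    by_contra! hE
    exact hlow lam (hlam.trans_lt hE) h0
  · refine ⟨![eigenfun μ e₀, eigenfun μ e₁], linearIndependent_eigenfun hlt.ne hD0 hD1, ?_⟩
    intro i
    fin_cases i
    · exact ⟨e₀, hlt.le, hG e₀ hD0⟩
    · exact ⟨e₁, le_rfl, hG e₁ hD1⟩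
  · rintro E ⟨u, hli, hu⟩
    by_contra! hE
    -- Both eigenvalues would be the lowest one, which is simple.
    have hmul : ∀ i, ∃ C : ℂ, C ≠ 0 ∧ u i = C • eigenfun μ e₀ := fun i => by
      obtain ⟨lam, hlam, h⟩ := hu i
      obtain ⟨C, hC, huC, h0⟩ := hzero lam (u i) (hli.ne_zero i) h
      have hle : e₀ ≤ lam := not_lt.1 fun h' => hlow lam h' h0
      have heq : e₀ = lam := by
        by_contra hne'
        have h1 : e₀ < lam := lt_of_le_of_ne hle hne'
        have h2 := hgap lam h1 h0 1 one_pos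
        exact absurd (hmin ⟨by linarith, h0⟩) (not_le.2 (hlam.trans_lt hE))
      exact ⟨C, hC, by rw [huC, heq]⟩
    obtain ⟨C, hC, h0⟩ := hmul 0
    obtain ⟨C', hC', h1⟩ := hmul 1
    have hpair : LinearIndependent ℂ ![u 0, u 1] := by
      convert hli using 1
      ext i
      fin_cases i <;> rfl
    refine hC' (LinearIndependent.pair_iff.1 hpair C' (-C) ?_).1
    rw [h0, h1, smul_smul, smul_smul, ← add_smul]
    rw [show C' * C + -C * C' = 0 by ring, zero_smul]

end Spectrum

/-! ### The mass of the potential -/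

theorem measureReal_densityMeasure {W : ℝ → ℝ} (hW : ContinuousOn W (Icc 0 1))
    (hW0 : ∀ x ∈ Icc (0 : ℝ) 1, 0 ≤ W x) :
    (densityMeasure W).real (Icc 0 1) = ∫ x in (0 : ℝ)..1, W x := by
  have h := setIntegral_densityMeasure hW hW0 (fun _ => (1 : ℝ)) measurableSet_Icc subset_rfl
  rw [integral_Icc_eq_integral_Ioc (f := fun t => W t • (1 : ℝ)),
    ← intervalIntegral.integral_of_le zero_le_one] at h
  simpa using h

theorem scattererPotential_univ (m : ℕ) {σ γ : ℝ} (hσ : 0 ≤ σ) (hγ : 0 ≤ γ) (z : Fin m → ℝ)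
    {ψ : ℝ → ℂ} (hψ : ∫ x in (0 : ℝ)..1, ‖ψ x‖ ^ 2 = 1) :
    scattererPotential m σ γ z ψ univ = ENNReal.ofReal (m * σ + γ) := by
  have hi : IntegrableOn (fun x => ‖ψ x‖ ^ 2) (Icc 0 1) volume := by
    rw [← intervalIntegrable_iff_integrableOn_Icc_of_le zero_le_one]
    by_contra h
    rw [intervalIntegral.integral_undef h] at hψ
    exact zero_ne_one hψ
  have h1 : ∫⁻ x, ENNReal.ofReal (γ * ‖ψ x‖ ^ 2) ∂unitVolume = ENNReal.ofReal γ := by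
    rw [unitVolume, ← ofReal_integral_eq_lintegral_ofReal (hi.const_mul γ)
      (Eventually.of_forall fun x => by positivity), integral_const_mul,
      integral_Icc_eq_integral_Ioc, ← intervalIntegral.integral_of_le zero_le_one, hψ, mul_one]
  rw [scattererPotential, Measure.add_apply, withDensity_apply _ MeasurableSet.univ,
    Measure.restrict_univ, h1, Measure.smul_apply, Measure.finsetSum_apply]
  simp only [measure_univ, Finset.sum_const, Finset.card_univ, Fintype.card_fin, smul_eq_mul,
    nsmul_eq_mul, mul_one]
  rw [ENNReal.ofReal_add (by positivity) hγ, mul_comm (m : ℝ), ENNReal.ofReal_mul hσ,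
    ENNReal.ofReal_natCast]

end EnergyGap

theorem mainTheorem4 :
    (∀ W : ℝ → ℝ, ContinuousOn W (Set.Icc 0 1) → (∀ x ∈ Set.Icc (0 : ℝ) 1, 0 ≤ W x) →
      ∃ e₀ e₁ : ℝ,
        EnergyGap.IsNthEigenvalue (EnergyGap.SchrodingerGraph W) 0 e₀ ∧
        EnergyGap.IsNthEigenvalue (EnergyGap.SchrodingerGraph W) 1 e₁ ∧
        0 < e₀ ∧ e₀ < e₁ ∧
        ∀ η : ℝ, 0 < η → η ^ 2 = Real.pi ^ 2 + 3 * ∫ x in (0 : ℝ)..1, W x →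
          η * Real.log (1 + Real.pi * Real.exp (-2 * η)) ≤ e₁ - e₀) ∧
    (∀ (m : ℕ) (σ γ : ℝ), 0 ≤ σ → 0 ≤ γ →
      ∀ z : Fin m → ℝ, (∀ i, z i ∈ Set.Icc (0 : ℝ) 1) →
      ∀ ψ ψ' : ℝ → ℂ, EnergyGap.IsH10 ψ ψ' → ∫ x in (0 : ℝ)..1, ‖ψ x‖ ^ 2 = 1 →
      ∃ e₀ e₁ : ℝ,
        EnergyGap.IsNthEigenvalue
          (EnergyGap.FormGraph (EnergyGap.scattererPotential m σ γ z ψ)) 0 e₀ ∧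
        EnergyGap.IsNthEigenvalue
          (EnergyGap.FormGraph (EnergyGap.scattererPotential m σ γ z ψ)) 1 e₁ ∧
        0 < e₀ ∧ e₀ < e₁ ∧
        ∀ η : ℝ, η = Real.sqrt (Real.pi ^ 2 + 3 * m * σ + 3 * γ) →
          η * Real.log (1 + Real.pi * Real.exp (-2 * η)) ≤ e₁ - e₀) := by
  constructor
  · intro W hW hW0
    have := EnergyGap.isFiniteMeasure_densityMeasure hW
    obtain ⟨e₀, e₁, h0, h1, hpos, hlt, hgap⟩ := EnergyGap.exists_eigenvalues_of_graph
      (μ := EnergyGap.densityMeasure W) (G := EnergyGap.SchrodingerGraph W)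
      (fun _ h => EnergyGap.schrodingerGraph_eigenfun hW hW0 h)
      (fun _ _ h => h.eq_smul_eigenfun hW hW0)
    refine ⟨e₀, e₁, h0, h1, hpos, hlt, fun η hη hη2 => ?_⟩
    refine (EnergyGap.mul_log_le_exp_neg hη measureReal_nonneg ?_).trans
      (hgap (η / 2) (by positivity))
    rw [EnergyGap.measureReal_densityMeasure hW hW0, hη2]
  · intro m σ γ hσ hγ z _ ψ ψ' _ hψ
    have huniv := EnergyGap.scattererPotential_univ m hσ hγ z hψ
    have : IsFiniteMeasure (EnergyGap.scattererPotential m σ γ z ψ) :=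
      ⟨by rw [huniv]; exact ENNReal.ofReal_lt_top⟩
    obtain ⟨e₀, e₁, h0, h1, hpos, hlt, hgap⟩ := EnergyGap.exists_eigenvalues_of_graph
      (μ := EnergyGap.scattererPotential m σ γ z ψ)
      (fun _ h => EnergyGap.formGraph_eigenfun h) (fun _ _ h => h.eq_smul_eigenfun)
    refine ⟨e₀, e₁, h0, h1, hpos, hlt, fun η hη => ?_⟩
    have hsum : 0 < Real.pi ^ 2 + 3 * m * σ + 3 * γ := by positivity
    have hη0 : 0 < η := by rw [hη]; exact Real.sqrt_pos.2 hsum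
    have hη2 : η ^ 2 = Real.pi ^ 2 + 3 * m * σ + 3 * γ := by rw [hη, Real.sq_sqrt hsum.le]
    refine (EnergyGap.mul_log_le_exp_neg hη0 measureReal_nonneg ?_).trans
      (hgap (η / 2) (by positivity))
    have hM : (EnergyGap.scattererPotential m σ γ z ψ).real (Set.Icc 0 1) ≤ m * σ + γ := by
      refine (measureReal_mono (Set.subset_univ _)).trans (le_of_eq ?_)
      rw [measureReal_def, huniv, ENNReal.toReal_ofReal (by positivity)]
    rw [hη2]
    linarith
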